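/- For each $n\in\mathbb N$ let $(d_{n,i})_{i=1}^n$ (degrees) and $(\theta_{n,i})_{i=1}^n$ (thresholds) be nonnegative integers with $\sum_i d_{n,i}$ even. Let $p$ be a probability distribution on $\mathbb N^2$ ($\mathbb N$ including $0$) such that $\frac1n\#\{i: d_{n,i}=d,\ \theta_{n,i}=\theta\}\to p(d,\theta)$ as $n\to\infty$ for all $d,\theta\in\mathbb N$, $\sum_{\theta\ge0}p(0,\theta)<1$, and $\sum_{i=1}^n A^{d_{n,i}}=O(n)$ for every $A>1$. Put $$\lambda=\sum_{d,\theta\ge 0} d\,p(d,\theta),\qquad h_B(z)=\sum_{d\ge1}\sum_{\theta\ge1}\ \sum_{\ell=(d-\theta)_+}^{d}\ell\,p(d,\theta)\binom d\ell z^\ell(1-z)^{d-\ell},\qquad \widehat z=\sup\{z\in[0,1]:\lambda z^2=h_B(z)\}.$$ Consider the following process. Bin $i\in\{1,\dots,n\}$ contains $d_{n,i}$ balls, all initially white. At any time, bin $i$ (with all its balls) is of type $A$ if $\theta_{n,i}=0$ or if it has fewer than $d_{n,i}-\theta_{n,i}$ white balls left, and of type $B$ otherwise. The balls have independent exponential lifetimes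 with mean $1$. At time $0$ a uniformly random white $A$-ball is recoloured red. Subsequently, whenever a white ball dies it is removed, and then a white $A$-ball, chosen uniformly at random (independently of the other choices and of the lifetimes), is recoloured red. The process stops when an $A$-ball has to be recoloured but there is no white $A$-ball. Let $H_A(t)$ be the number of white $A$-balls at time $t$, with $H_A=-1$ from the moment when the process stops, and let $\tau_n$ be the first time $t\ge0$ with $H_A(t)=-1$. Assume that, if $\widehat z\ne0$, then $\widehat z$ is not a local minimum of $z\mapsto\lambda z^2-h_B(z)$ on $[0,1]$. Then $\tau_n\to-\ln\widehat z$ in probability as $n\to\infty$. That is, if $\widehat z\neq 0$, then $\mathbb P(|\tau_n+\ln\widehat z|>\varepsilon)\to0$ for every $\varepsilon>0$; and if $\widehat z=0$ (where $-\ln\widehat z=+\infty$), then $\mathbb P(\tau_n\le K)\to0$ for every real $K$. -/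

import Mathlib

open Filter Topology MeasureTheory ProbabilityTheory

noncomputable section

namespace ThresholdDiffusion

/-! ### Degrees, thresholds and the regularity condition -/

/-- The number of nodes with degree `a` and threshold `b`. -/
def numNodes {n : ℕ} (d θ : Fin n → ℕ) (a b : ℕ) : ℕ :=
  (Finset.univ.filter fun i => d i = a ∧ θ i = b).card

/-- The regularity condition on the degrees `d n i` and the thresholds `θ n i`, with limiting
joint distribution `p` of (degree, threshold). -/
structure Regular (d θ : (n : ℕ) → Fin n → ℕ) (p : ℕ × ℕ → ℝ) : Prop where
  even_sum : ∀ n, Even (∑ i, d n i)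
  p_nonneg : ∀ x, 0 ≤ p x
  p_sum : HasSum p 1
  tendsto_freq : ∀ a b : ℕ,
    Tendsto (fun n : ℕ => (numNodes (d n) (θ n) a b : ℝ) / n) atTop (𝓝 (p (a, b)))
  degree_zero : ∑' b : ℕ, p (0, b) < 1
  moments : ∀ A : ℝ, 1 < A →
    (fun n : ℕ => ∑ i, A ^ d n i) =O[atTop] (fun n : ℕ => (n : ℝ))

/-! ### The limiting functions -/

/-- The mean `λ` of the limiting degree. -/
def meanDegree (p : ℕ × ℕ → ℝ) : ℝ := ∑' x : ℕ × ℕ, (x.1 : ℝ) * p x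

/-- The probability that a binomial variable with parameters `d`, `z` equals `l`. -/
def binomProb (d : ℕ) (z : ℝ) (l : ℕ) : ℝ := (d.choose l : ℝ) * z ^ l * (1 - z) ^ (d - l)

/-- `h_B(z) = ∑_{d ≥ 1} ∑_{θ ≥ 1} ∑_{l ≥ d - θ} l p(d,θ) P(Bin(d,z) = l)`, with `l` ranging over
`0 ≤ l ≤ d` (the terms with `d = 0` vanish). -/
def hB (p : ℕ × ℕ → ℝ) (z : ℝ) : ℝ :=
  ∑' x : ℕ × ℕ, if 1 ≤ x.2 then
    ∑ l ∈ Finset.Icc (x.1 - x.2) x.1, (l : ℝ) * p x * binomProb x.1 z l else 0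

/-- `λ z² - h_B(z)`. -/
def driftFn (p : ℕ × ℕ → ℝ) (z : ℝ) : ℝ := meanDegree p * z ^ 2 - hB p z

/-- The largest root of `λ z² = h_B(z)` in `[0, 1]`. -/
def zHat (p : ℕ × ℕ → ℝ) : ℝ := sSup {z : ℝ | z ∈ Set.Icc (0 : ℝ) 1 ∧ driftFn p z = 0}

/-! ### The balls-and-bins process -/

/-- The balls (half-edges): bin `i` contains `d i` balls. -/
abbrev Ball {n : ℕ} (d : Fin n → ℕ) : Type := (i : Fin n) × Fin (d i)

/-- A rule that picks an element of every nonempty finite set. -/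
abbrev Selector (β : Type) : Type := (S : {S : Finset β // S.Nonempty}) → {b : β // b ∈ S.1}

/-- The white balls (alive and not recoloured), the time of the last event, and whether the process
has stopped because a white `A`-ball had to be recoloured and there was none. -/
structure State {n : ℕ} (d : Fin n → ℕ) where
  white : Finset (Ball d)
  time : ℝ
  stopped : Bool

section BallProcess

variable {n : ℕ} (d θ : Fin n → ℕ)

/-- The white `A`-balls when `V` is the set of white balls. Bin `i` is of type `A` if its threshold
is zero or if it has fewer than `d i - θ i` white balls left (never, if `d i ≤ θ i`), and of type
`B` otherwise. -/
def whiteA (V : Finset (Ball d)) : Finset (Ball d) :=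
  V.filter fun b => θ b.1 = 0 ∨ (V.filter fun c => c.1 = b.1).card < d b.1 - θ b.1

/-- At time `t`, recolour one white `A`-ball red; the process stops if there is none. -/
def recolour (pick : Selector (Ball d)) (V : Finset (Ball d)) (t : ℝ) : State d :=
  if h : (whiteA d θ V).Nonempty then ⟨V.erase (pick ⟨whiteA d θ V, h⟩).1, t, false⟩
  else ⟨V, t, true⟩

variable {d}

/-- The ball of `V` that dies first, when `T b` is the lifetime of the ball `b`. -/
def firstDeath (T : Ball d → ℝ) (V : Finset (Ball d)) (h : V.Nonempty) : Ball d :=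
  (V.exists_min_image T h).choose

/-- The next white ball dies, and then a white `A`-ball is recoloured red. -/
def step (T : Ball d → ℝ) (pick : Selector (Ball d)) (s : State d) : State d :=
  if s.stopped then s
  else if h : s.white.Nonempty then
    recolour d θ pick (s.white.erase (firstDeath T s.white h)) (T (firstDeath T s.white h))
  else s

/-- The state after `k` deaths of white balls (constant once the process has stopped). All balls
are white at first, and one white `A`-ball is recoloured red at time `0`. -/
def chain (T : Ball d → ℝ) (R : ℕ → Selector (Ball d)) : ℕ → State d
  | 0 => recolour d θ (R 0) Finset.univ 0
  | k + 1 => step θ T (R (k + 1)) (chain T R k)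

/-- The state at time `t`: that of the last event up to time `t`. There are no more events than
balls. -/
def stateAt (T : Ball d → ℝ) (R : ℕ → Selector (Ball d)) (t : ℝ) : State d :=
  chain θ T R (Nat.findGreatest (fun k => (chain θ T R k).time ≤ t) (Fintype.card (Ball d)))

/-- `H_A(t)`: the number of white `A`-balls at time `t`, and `-1` once the process has stopped. -/
def HA (T : Ball d → ℝ) (R : ℕ → Selector (Ball d)) (t : ℝ) : ℤ :=
  if (stateAt θ T R t).stopped then -1 else ((whiteA d θ (stateAt θ T R t).white).card : ℤ)

/-- The first time `τ ≥ 0` with `H_A(τ) = -1`. -/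
def tau (T : Ball d → ℝ) (R : ℕ → Selector (Ball d)) : ℝ :=
  sInf {t : ℝ | 0 ≤ t ∧ HA θ T R t = -1}

end BallProcess

/-- The randomness of the process: the lifetimes `T b` are independent exponential variables with
mean `1`; the ball recoloured after the `k`-th death is uniform among the white `A`-balls present
(`R k ω S` is uniform on `S` for each nonempty `S`); the choices for different `k` are independent
of each other, and jointly independent of the lifetimes. -/
structure IsDriver {β Ω : Type*} [Fintype β] [MeasurableSpace β] [MeasurableSpace Ω]
    (P : Measure Ω) (T : β → Ω → ℝ)
    (R : ℕ → Ω → (S : {S : Finset β // S.Nonempty}) → {b : β // b ∈ S.1}) : Prop where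
  measurable_T : ∀ b, Measurable (T b)
  law_T : ∀ b, P.map (T b) = expMeasure 1
  indep_T : iIndepFun T P
  measurable_R : ∀ k, Measurable (R k)
  law_R : ∀ (k : ℕ) (S : {S : Finset β // S.Nonempty}) (b : {b : β // b ∈ S.1}),
    P {ω | R k ω S = b} = (S.1.card : ENNReal)⁻¹
  indep_R : iIndepFun R P
  indep_T_R : IndepFun (fun ω b => T b ω) (fun ω k => R k ω) P

/-! ### The first time with `H_A = -1` exists -/

section WellDefined

variable {n : ℕ} {d : Fin n → ℕ} (θ : Fin n → ℕ)

theorem recolour_time (pick : Selector (Ball d)) (V : Finset (Ball d)) (t : ℝ) :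
    (recolour d θ pick V t).time = t := by
  unfold recolour; split_ifs <;> rfl

theorem recolour_card (pick : Selector (Ball d)) (V : Finset (Ball d)) (t : ℝ)
    (h : (recolour d θ pick V t).stopped = false) :
    (recolour d θ pick V t).white.card + 1 = V.card ∧ (recolour d θ pick V t).white ⊆ V := by
  unfold recolour at h ⊢
  split_ifs at h ⊢ with h1
  · have hm : (pick ⟨whiteA d θ V, h1⟩).1 ∈ V :=
      Finset.filter_subset _ _ (pick ⟨whiteA d θ V, h1⟩).2
    exact ⟨Finset.card_erase_add_one hm, Finset.erase_subset _ _⟩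

theorem firstDeath_mem (T : Ball d → ℝ) (V : Finset (Ball d)) (h : V.Nonempty) :
    firstDeath T V h ∈ V := (V.exists_min_image T h).choose_spec.1

theorem firstDeath_le (T : Ball d → ℝ) (V : Finset (Ball d)) (h : V.Nonempty) {b : Ball d}
    (hb : b ∈ V) : T (firstDeath T V h) ≤ T b := (V.exists_min_image T h).choose_spec.2 b hb

/-- While the process runs, each round removes two white balls. -/
theorem chain_card (T : Ball d → ℝ) (R : ℕ → Selector (Ball d)) (he : Even (∑ i, d i)) (k : ℕ)
    (h : (chain θ T R k).stopped = false) :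
    (chain θ T R k).white.card + (2 * k + 1) = Fintype.card (Ball d) := by
  induction k with
  | zero =>
    have := (recolour_card θ (R 0) Finset.univ 0 h).1
    simpa [chain] using this
  | succ k ih =>
    have hs : (chain θ T R k).stopped = false := by
      by_contra hc
      simp only [chain, step] at h
      simp_all
    have ih := ih hs
    have hc : Fintype.card (Ball d) = ∑ i, d i := by simp [Ball]
    have hne : (chain θ T R k).white.Nonempty := by
      rw [← Finset.card_pos]
      obtain ⟨m, hm⟩ := he
      omega
    have e : chain θ T R (k + 1) = recolour d θ (R (k + 1))
        ((chain θ T R k).white.erase (firstDeath T _ hne)) (T (firstDeath T _ hne)) := by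
      simp [chain, step, hs, hne]
    rw [e] at h ⊢
    have h1 := (recolour_card θ _ _ _ h).1
    have h2 := Finset.card_erase_add_one (firstDeath_mem T _ hne)
    omega

/-- Event times increase, and all white balls are still to die. -/
theorem chain_time (T : Ball d → ℝ) (R : ℕ → Selector (Ball d)) (hT : ∀ b, 0 ≤ T b) (k : ℕ) :
    (chain θ T R k).time ≤ (chain θ T R (k + 1)).time ∧
      ((chain θ T R k).stopped = false →
        ∀ b ∈ (chain θ T R k).white, (chain θ T R k).time ≤ T b) := by
  have key : ∀ k, (chain θ T R k).stopped = false →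
      ∀ b ∈ (chain θ T R k).white, (chain θ T R k).time ≤ T b := by
    intro k
    induction k with
    | zero => intro _ b _; simpa [chain, recolour_time] using hT b
    | succ k ih =>
      intro h b hb
      have hs : (chain θ T R k).stopped = false := by
        by_contra hc
        simp only [chain, step] at h
        simp_all
      by_cases hne : (chain θ T R k).white.Nonempty
      · have e : chain θ T R (k + 1) = recolour d θ (R (k + 1))
            ((chain θ T R k).white.erase (firstDeath T _ hne)) (T (firstDeath T _ hne)) := by
          simp [chain, step, hs, hne]
        rw [e] at h hb ⊢
        rw [recolour_time]
        exact firstDeath_le T _ hne (Finset.mem_of_mem_erase ((recolour_card θ _ _ _ h).2 hb))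
      · have e : chain θ T R (k + 1) = chain θ T R k := by simp [chain, step, hne]
        rw [e] at hb ⊢
        exact ih hs b hb
  refine ⟨?_, key k⟩
  by_cases hs : (chain θ T R k).stopped = false
  · by_cases hne : (chain θ T R k).white.Nonempty
    · have e : chain θ T R (k + 1) = recolour d θ (R (k + 1))
          ((chain θ T R k).white.erase (firstDeath T _ hne)) (T (firstDeath T _ hne)) := by
        simp [chain, step, hs, hne]
      rw [e, recolour_time]
      exact key k hs _ (firstDeath_mem T _ hne)
    · simp [chain, step, hne]
  · simp [chain, step, hs]

/-- If all lifetimes are nonnegative, the process stops: `tau` is the least time `t ≥ 0` with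
`H_A(t) = -1`. -/
theorem isLeast_tau (T : Ball d → ℝ) (R : ℕ → Selector (Ball d)) (he : Even (∑ i, d i))
    (hT : ∀ b, 0 ≤ T b) : IsLeast {t : ℝ | 0 ≤ t ∧ HA θ T R t = -1} (tau θ T R) := by
  have hmono : Monotone fun k => (chain θ T R k).time :=
    monotone_nat_of_le_succ fun k => (chain_time θ T R hT k).1
  have h0 : (chain θ T R 0).time = 0 := by simp [chain, recolour_time]
  set N := Fintype.card (Ball d) with hN
  have hst : (chain θ T R N).stopped = true := by
    by_contra hc
    have := chain_card θ T R he N (by simpa using hc)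
    omega
  have hex : ∃ k, (chain θ T R k).stopped = true := ⟨N, hst⟩
  classical
  set K := Nat.find hex with hK
  have hKs : (chain θ T R K).stopped = true := Nat.find_spec hex
  have hKN : K ≤ N := Nat.find_min' hex hst
  have hfrozen : ∀ j, chain θ T R (K + j) = chain θ T R K := by
    intro j
    induction j with
    | zero => rfl
    | succ j ih =>
      have : chain θ T R (K + (j + 1)) = step θ T (R (K + j + 1)) (chain θ T R (K + j)) := rfl
      rw [this, ih]; simp [step, hKs]
  have hge : ∀ j, K ≤ j → chain θ T R j = chain θ T R K := by
    intro j hj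
    obtain ⟨i, rfl⟩ := Nat.exists_eq_add_of_le hj
    exact hfrozen i
  have hset : {t : ℝ | 0 ≤ t ∧ HA θ T R t = -1} = Set.Ici (chain θ T R K).time := by
    ext t
    have hnn : 0 ≤ (chain θ T R K).time := by
      have := hmono (Nat.zero_le K); simp only [h0] at this; exact this
    simp only [Set.mem_ofPred_eq, Set.mem_Ici]
    constructor
    · rintro ⟨ht, hA⟩
      have hfin : (stateAt θ T R t).stopped = true := by
        by_contra hc
        simp only [HA, hc] at hA
        simp at hA
      have hle := Nat.find_min' hex hfin
      refine (hmono hle).trans ?_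
      exact Nat.findGreatest_spec (P := fun k => (chain θ T R k).time ≤ t) (Nat.zero_le _)
        (by simpa [h0] using ht)
    · intro ht
      refine ⟨hnn.trans ht, ?_⟩
      have hNt : (chain θ T R N).time ≤ t := by rw [hge N hKN]; exact ht
      have : K ≤ Nat.findGreatest (fun k => (chain θ T R k).time ≤ t) N :=
        hKN.trans (Nat.le_findGreatest le_rfl hNt)
      simp [HA, stateAt, ← hN, hge _ this, hKs]
  unfold tau
  rw [hset, csInf_Ici]
  exact isLeast_Ici

end WellDefined

end ThresholdDiffusion

end

/-! A recolouring only touches a bin that is already of type `A`, and such a bin stays of type `A`.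
Hence a bin of type `B` has lost only dead balls, and whether it is of type `B` can be read off the
lifetimes alone. So the white `B`-balls at time `t` form the set `aliveB θ T t`, which decreases in
`t` and does not depend on the choices (`WhiteAt.card_eq`). On the other hand each round removes
exactly two white balls. With `M` balls in all, `M - 2k` are white just before the recolouring that
follows the `k`-th death, and the process stops there exactly when `aliveB` also has `M - 2k`
elements.

It remains to locate two random quantities. While `W` balls are white, the next death takes an
exponential time with mean `1 / W`, so the `k`-th death occurs near the sum of `1 / (M - 1 - 2j)`
over `j < k`, about `-log (1 - 2k / M) / 2`; equivalently `M - 2k ≈ n λ e^{-2t}` at time `t`. An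
exponential moment bound (`lintegral_expWait_le`), valid for every fixed sequence of choices, makes
this precise (`Regular.tendsto_centredTime`). The bins evolve independently under the lifetimes, so
Chebyshev's inequality gives `|aliveB| ≈ n h_B(e^{-t})` (`Regular.tendsto_card_aliveB`).

With `z = e^{-t}`, the number of white `A`-balls is therefore about `n (λ z² - h_B(z))`. This drift
is positive on `(ẑ, 1]`, so the process survives until shortly before `-log ẑ`; since `ẑ` is a zero
but not a local minimum, the drift is negative at points just below `ẑ`, which forces a stop soon
after. The state is frozen after stopping and `aliveB` is monotone, so both directions need the
death time at a single index `k` only, and no maximal inequality (`tau_le_of`, `lt_tau_of`). -/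

noncomputable section

namespace ThresholdDiffusion

/-! ### Pathwise analysis: white `B`-balls, the stopping criterion and the death times. -/

section Deterministic

variable {n : ℕ} {d : Fin n → ℕ} (θ : Fin n → ℕ)

/-- The number of balls of bin `i` whose lifetime exceeds `t`. -/
def aliveIn (T : Ball d → ℝ) (i : Fin n) (t : ℝ) : ℕ :=
  (Finset.univ.filter fun c : Ball d => c.1 = i ∧ t < T c).card

/-- The balls alive at time `t` in the bins that are of type `B` at time `t`. -/
def aliveB (T : Ball d → ℝ) (t : ℝ) : Finset (Ball d) :=
  Finset.univ.filter fun b => t < T b ∧ θ b.1 ≠ 0 ∧ d b.1 - θ b.1 ≤ aliveIn T b.1 t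

theorem aliveIn_anti (T : Ball d → ℝ) (i : Fin n) : Antitone (aliveIn T i) := by
  intro s t hst
  refine Finset.card_le_card fun c hc => ?_
  simp only [Finset.mem_filter, Finset.mem_univ, true_and] at hc ⊢
  exact ⟨hc.1, hst.trans_lt hc.2⟩

theorem aliveB_anti (T : Ball d → ℝ) : Antitone (aliveB θ T) := by
  intro s t hst b hb
  simp only [aliveB, Finset.mem_filter, Finset.mem_univ, true_and] at hb ⊢
  exact ⟨hst.trans_lt hb.1, hb.2.1, hb.2.2.trans (aliveIn_anti T b.1 hst)⟩

/-- All balls of `V` are alive at time `t`, and all balls alive at time `t` that are not in `V`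
lie in bins of type `A`. -/
def WhiteAt (T : Ball d → ℝ) (V : Finset (Ball d)) (t : ℝ) : Prop :=
  (∀ b ∈ V, t < T b) ∧
    ∀ b, t < T b → b ∉ V → θ b.1 = 0 ∨ aliveIn T b.1 t < d b.1 - θ b.1

variable {θ}

theorem WhiteAt.card_filter_le {T : Ball d → ℝ} {V : Finset (Ball d)} {t : ℝ}
    (h : WhiteAt θ T V t) (i : Fin n) : (V.filter fun c => c.1 = i).card ≤ aliveIn T i t := by
  refine Finset.card_le_card fun c hc => ?_
  simp only [Finset.mem_filter, Finset.mem_univ, true_and] at hc ⊢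
  exact ⟨hc.2, h.1 c hc.1⟩

/-- In a bin that is of type `B` by its alive count, every alive ball is white, so its alive and
white counts agree. In general the white count is at most the alive count. Hence the white `B`-balls
are exactly `aliveB θ T t`, whatever was recoloured. -/
theorem WhiteAt.card_eq {T : Ball d → ℝ} {V : Finset (Ball d)} {t : ℝ} (h : WhiteAt θ T V t) :
    (whiteA d θ V).card + (aliveB θ T t).card = V.card := by
  rw [whiteA, ← Finset.card_filter_add_card_filter_not (s := V) (fun b => θ b.1 = 0 ∨
    (V.filter fun c => c.1 = b.1).card < d b.1 - θ b.1)]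
  congr 2
  ext b
  simp only [aliveB, Finset.mem_filter, Finset.mem_univ, true_and, not_or, not_lt]
  constructor
  · rintro ⟨hb, h0, hle⟩
    have hV : b ∈ V := by
      by_contra hc
      rcases h.2 b hb hc with h1 | h1
      · exact h0 h1
      · omega
    refine ⟨hV, h0, hle.trans (Finset.card_le_card fun c hc => ?_)⟩
    simp only [Finset.mem_filter, Finset.mem_univ, true_and] at hc ⊢
    refine ⟨?_, hc.1⟩
    by_contra hcV
    rcases h.2 c hc.2 hcV with h1 | h1
    · rw [hc.1] at h1; exact h0 h1
    · rw [hc.1] at h1; omega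
  · rintro ⟨hb, h0, hle⟩
    exact ⟨h.1 b hb, h0, hle.trans (h.card_filter_le b.1)⟩

theorem WhiteAt.erase_firstDeath {T : Ball d → ℝ} (hT : Function.Injective T)
    {V : Finset (Ball d)} {t : ℝ} (h : WhiteAt θ T V t) (hV : V.Nonempty) :
    WhiteAt θ T (V.erase (firstDeath T V hV)) (T (firstDeath T V hV)) := by
  have hle : t ≤ T (firstDeath T V hV) := (h.1 _ (firstDeath_mem T V hV)).le
  constructor
  · intro b hb
    rw [Finset.mem_erase] at hb
    exact lt_of_le_of_ne (firstDeath_le T V hV hb.2) fun he => hb.1 (hT he).symm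
  · intro b hb hbV
    have hne : b ≠ firstDeath T V hV := by rintro rfl; exact lt_irrefl _ hb
    have hb' : b ∉ V := fun hc => hbV (Finset.mem_erase.2 ⟨hne, hc⟩)
    rcases h.2 b (hle.trans_lt hb) hb' with h1 | h1
    · exact Or.inl h1
    · exact Or.inr ((aliveIn_anti T b.1 hle).trans_lt h1)

/-- Only the recoloured ball `c` needs care: its bin is of type `A` by the white count. If the alive
count were at least `d - θ`, no alive ball of the bin could be missing from `V`, and the two counts
would coincide. -/
theorem WhiteAt.recolour {T : Ball d → ℝ} {V : Finset (Ball d)} {t : ℝ} (h : WhiteAt θ T V t)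
    (pick : Selector (Ball d)) (hs : (recolour d θ pick V t).stopped = false) :
    WhiteAt θ T (recolour d θ pick V t).white t := by
  unfold ThresholdDiffusion.recolour at hs ⊢
  split_ifs at hs ⊢ with h1
  have hm := (pick ⟨whiteA d θ V, h1⟩).2
  set c := (pick ⟨whiteA d θ V, h1⟩).1
  refine ⟨fun b hb => h.1 b (Finset.mem_of_mem_erase hb), fun b hb hbV => ?_⟩
  by_cases hbc : b = c
  · rw [hbc] at hb ⊢
    simp only [whiteA, Finset.mem_filter] at hm
    rcases hm.2 with h0 | h0
    · exact Or.inl h0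
    · by_contra hcon
      push Not at hcon
      have hsub : (aliveIn T c.1 t) ≤ (V.filter fun c' => c'.1 = c.1).card := by
        refine Finset.card_le_card fun x hx => ?_
        simp only [Finset.mem_filter, Finset.mem_univ, true_and] at hx ⊢
        refine ⟨?_, hx.1⟩
        by_contra hxV
        have := h.2 x hx.2 hxV
        rw [hx.1] at this
        rcases this with h2 | h2
        · exact hcon.1 h2
        · omega
      omega
  · exact h.2 b hb fun hc => hbV (Finset.mem_erase.2 ⟨hbc, hc⟩)

theorem recolour_stopped_iff (pick : Selector (Ball d)) (V : Finset (Ball d)) (t : ℝ) :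
    (recolour d θ pick V t).stopped = true ↔ whiteA d θ V = ∅ := by
  unfold recolour
  split_ifs with h
  · simpa [Finset.nonempty_iff_ne_empty] using h
  · simpa [Finset.not_nonempty_iff_eq_empty] using h

theorem WhiteAt.univ {T : Ball d → ℝ} (hT : ∀ b, 0 < T b) : WhiteAt θ T Finset.univ 0 :=
  ⟨fun b _ => hT b, fun b _ hb => absurd (Finset.mem_univ b) hb⟩

theorem chain_stopped_mono (T : Ball d → ℝ) (R : ℕ → Selector (Ball d)) {k l : ℕ} (hkl : k ≤ l)
    (h : (chain θ T R k).stopped = true) : chain θ T R l = chain θ T R k := by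
  induction l, hkl using Nat.le_induction with
  | base => rfl
  | succ l hl ih =>
    have : chain θ T R (l + 1) = step θ T (R (l + 1)) (chain θ T R l) := rfl
    rw [this, ih]
    simp [step, h]

theorem chain_succ_eq (T : Ball d → ℝ) (R : ℕ → Selector (Ball d)) (he : Even (∑ i, d i)) (k : ℕ)
    (hs : (chain θ T R k).stopped = false) :
    ∃ hne : (chain θ T R k).white.Nonempty, chain θ T R (k + 1) = recolour d θ (R (k + 1))
        ((chain θ T R k).white.erase (firstDeath T _ hne)) (T (firstDeath T _ hne)) := by
  have ih := chain_card θ T R he k hs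
  have hc : Fintype.card (Ball d) = ∑ i, d i := by simp [Ball]
  have hne : (chain θ T R k).white.Nonempty := by
    rw [← Finset.card_pos]
    obtain ⟨m, hm⟩ := he
    omega
  exact ⟨hne, by simp [chain, step, hs, hne]⟩

theorem chain_whiteAt {T : Ball d → ℝ} (hinj : Function.Injective T) (hT : ∀ b, 0 < T b)
    (R : ℕ → Selector (Ball d)) (he : Even (∑ i, d i)) (k : ℕ)
    (hs : (chain θ T R k).stopped = false) :
    WhiteAt θ T (chain θ T R k).white (chain θ T R k).time := by
  induction k with
  | zero =>
    have := (WhiteAt.univ (θ := θ) hT).recolour (R 0) hs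
    simpa [chain, recolour_time] using this
  | succ k ih =>
    have hs' : (chain θ T R k).stopped = false := by
      by_contra hc
      rw [chain_stopped_mono T R k.le_succ (by simpa using hc)] at hs
      simp_all
    obtain ⟨hne, e⟩ := chain_succ_eq T R he k hs'
    rw [e] at hs ⊢
    rw [recolour_time]
    exact ((ih hs').erase_firstDeath hinj hne).recolour _ hs

/-- The white balls just before the `k`-th recolouring. -/
theorem chain_before_recolour {T : Ball d → ℝ} (hinj : Function.Injective T) (hT : ∀ b, 0 < T b)
    (R : ℕ → Selector (Ball d)) (he : Even (∑ i, d i)) (k : ℕ)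
    (hs : ∀ j < k, (chain θ T R j).stopped = false) :
    ∃ V t, chain θ T R k = recolour d θ (R k) V t ∧ WhiteAt θ T V t ∧
      V.card + 2 * k = ∑ i, d i := by
  have hc : Fintype.card (Ball d) = ∑ i, d i := by simp [Ball]
  cases k with
  | zero => exact ⟨Finset.univ, 0, rfl, WhiteAt.univ hT, by simp⟩
  | succ k =>
    have hs' := hs k k.lt_succ_self
    obtain ⟨hne, e⟩ := chain_succ_eq T R he k hs'
    refine ⟨_, _, e, (chain_whiteAt hinj hT R he k hs').erase_firstDeath hinj hne, ?_⟩
    have h1 := chain_card θ T R he k hs'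
    have h2 := Finset.card_erase_add_one (firstDeath_mem T _ hne)
    omega

/-- Just before the `k`-th recolouring `M - 2k` balls are white, and the process goes on because at
least one of them is an `A`-ball; at the stop (next lemma) all of them are `B`-balls, hence the
equality. -/
theorem card_aliveB_of_running {T : Ball d → ℝ} (hinj : Function.Injective T) (hT : ∀ b, 0 < T b)
    (R : ℕ → Selector (Ball d)) (he : Even (∑ i, d i)) (k : ℕ)
    (hs : (chain θ T R k).stopped = false) :
    (aliveB θ T (chain θ T R k).time).card + 2 * k < ∑ i, d i := by
  obtain ⟨V, t, e, hV, hcard⟩ := chain_before_recolour hinj hT R he k fun j hj => by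
    by_contra hc
    rw [chain_stopped_mono T R hj.le (by simpa using hc)] at hs
    simp_all
  rw [e] at hs ⊢
  rw [recolour_time]
  have h1 := hV.card_eq
  have h2 : whiteA d θ V ≠ ∅ := fun h => by
    rw [(recolour_stopped_iff (R k) V t).2 h] at hs; simp at hs
  have h3 := Finset.card_pos.2 (Finset.nonempty_iff_ne_empty.2 h2)
  omega

theorem card_aliveB_of_stopped {T : Ball d → ℝ} (hinj : Function.Injective T) (hT : ∀ b, 0 < T b)
    (R : ℕ → Selector (Ball d)) (he : Even (∑ i, d i)) (k : ℕ)
    (hs : ∀ j < k, (chain θ T R j).stopped = false) (hk : (chain θ T R k).stopped = true) :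
    (aliveB θ T (chain θ T R k).time).card + 2 * k = ∑ i, d i := by
  obtain ⟨V, t, e, hV, hcard⟩ := chain_before_recolour hinj hT R he k hs
  rw [e] at hk ⊢
  rw [recolour_time]
  have h1 := hV.card_eq
  rw [(recolour_stopped_iff (R k) V t).1 hk, Finset.card_empty] at h1
  omega

theorem chain_time_mono (T : Ball d → ℝ) (R : ℕ → Selector (Ball d)) (hT : ∀ b, 0 ≤ T b) :
    Monotone fun k => (chain θ T R k).time :=
  monotone_nat_of_le_succ fun k => (chain_time θ T R hT k).1

/-- `tau` is the time of the first death after which the process has stopped. -/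
theorem exists_tau_eq (T : Ball d → ℝ) (R : ℕ → Selector (Ball d)) (he : Even (∑ i, d i))
    (hT : ∀ b, 0 ≤ T b) :
    ∃ K, (chain θ T R K).stopped = true ∧ (∀ j < K, (chain θ T R j).stopped = false) ∧
      tau θ T R = (chain θ T R K).time := by
  have hmono := chain_time_mono (θ := θ) T R hT
  have h0 : (chain θ T R 0).time = 0 := by simp [chain, recolour_time]
  set N := Fintype.card (Ball d) with hN
  have hst : (chain θ T R N).stopped = true := by
    by_contra hc
    have := chain_card θ T R he N (by simpa using hc)
    omega
  have hex : ∃ k, (chain θ T R k).stopped = true := ⟨N, hst⟩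
  classical
  refine ⟨Nat.find hex, Nat.find_spec hex, fun j hj => by simpa using Nat.find_min hex hj, ?_⟩
  have hleast := isLeast_tau θ T R he hT
  have hKN : Nat.find hex ≤ N := Nat.find_min' hex hst
  set K := Nat.find hex
  have hKs : (chain θ T R K).stopped = true := Nat.find_spec hex
  have hnn : 0 ≤ (chain θ T R K).time := by
    have := hmono (Nat.zero_le K); simp only [h0] at this; exact this
  refine le_antisymm (hleast.2 ⟨hnn, ?_⟩) ?_
  · have hNt : (chain θ T R N).time ≤ (chain θ T R K).time := by
      rw [chain_stopped_mono T R hKN hKs]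
    have : K ≤ Nat.findGreatest (fun k => (chain θ T R k).time ≤ (chain θ T R K).time) N :=
      hKN.trans (Nat.le_findGreatest le_rfl hNt)
    simp [HA, stateAt, ← hN, chain_stopped_mono T R this hKs, hKs]
  · obtain ⟨ht, hA⟩ := hleast.1
    have hfin : (stateAt θ T R (tau θ T R)).stopped = true := by
      by_contra hc
      simp only [HA, hc] at hA
      simp at hA
    have hle : K ≤ _ := Nat.find_min' hex hfin
    refine (hmono hle).trans ?_
    exact Nat.findGreatest_spec (P := fun k => (chain θ T R k).time ≤ tau θ T R)
      (Nat.zero_le _) (by simpa [h0] using ht)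

/-- The sum of the mean waiting times for the first `k` deaths (those before the process stops). -/
def compensator (θ : Fin n → ℕ) (T : Ball d → ℝ) (R : ℕ → Selector (Ball d)) (k : ℕ) : ℝ :=
  ∑ j ∈ Finset.range k, if (chain θ T R j).stopped then 0 else
    1 / ((chain θ T R j).white.card : ℝ)

/-- The sum of the mean waiting times for `k` deaths if there are `M` balls. -/
def meanTime (M k : ℕ) : ℝ := ∑ j ∈ Finset.range k, 1 / ((M : ℝ) - 1 - 2 * j)

theorem compensator_of_running (T : Ball d → ℝ) (R : ℕ → Selector (Ball d))
    (he : Even (∑ i, d i)) (k : ℕ) (hs : ∀ j < k, (chain θ T R j).stopped = false) :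
    compensator θ T R k = meanTime (∑ i, d i) k := by
  refine Finset.sum_congr rfl fun j hj => ?_
  have h := hs j (Finset.mem_range.1 hj)
  have hc : Fintype.card (Ball d) = ∑ i, d i := by simp [Ball]
  have h1 := chain_card θ T R he j h
  rw [if_neg (by simp [h])]
  congr 1
  rw [← hc, ← h1]
  push_cast
  ring

theorem compensator_of_stopped (T : Ball d → ℝ) (R : ℕ → Selector (Ball d)) {K k : ℕ}
    (hK : (chain θ T R K).stopped = true) (hKk : K ≤ k) :
    compensator θ T R k = compensator θ T R K := by
  symm
  refine Finset.sum_subset (Finset.range_mono hKk) fun j _ hj => ?_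
  have hj' : K ≤ j := by simpa using hj
  rw [chain_stopped_mono T R hj' hK]
  simp [hK]

theorem meanTime_mono {M k l : ℕ} (hkl : k ≤ l) (hl : 2 * l ≤ M) :
    meanTime M k ≤ meanTime M l := by
  refine Finset.sum_le_sum_of_subset_of_nonneg (Finset.range_mono hkl) fun j hj _ => ?_
  have hj' : j < l := Finset.mem_range.1 hj
  have h2 : (2 * j + 1 : ℝ) ≤ M := by exact_mod_cast (by omega : 2 * j + 1 ≤ M)
  have : (0 : ℝ) ≤ (M : ℝ) - 1 - 2 * j := by linarith
  positivity

/-- If the `k`-th death is not late and there are many alive balls in bins of type `B` at time `t`,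
then the process stops before `t`. -/
theorem tau_le_of {T : Ball d → ℝ} (hinj : Function.Injective T) (hT : ∀ b, 0 < T b)
    (R : ℕ → Selector (Ball d)) (he : Even (∑ i, d i)) {k : ℕ} {t η : ℝ}
    (hk : 2 * k ≤ ∑ i, d i)
    (hY : (chain θ T R k).time ≤ compensator θ T R k + η)
    (ht : meanTime (∑ i, d i) k + η ≤ t)
    (hB : ∑ i, d i ≤ (aliveB θ T t).card + 2 * k) : tau θ T R ≤ t := by
  obtain ⟨K, hKs, hKr, htau⟩ := exists_tau_eq (θ := θ) T R he fun b => (hT b).le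
  have hmono := chain_time_mono (θ := θ) T R fun b => (hT b).le
  rw [htau]
  -- If the process has stopped by round `k`, time and compensator are frozen at round `K`, so the
  -- bound at index `k` is one at index `K`. Otherwise a running process has fewer than `M - 2k`
  -- balls in `aliveB` at the `k`-th death, hence also at the later time `t`.
  by_cases hKk : K ≤ k
  · have h1 := chain_stopped_mono T R hKk hKs
    rw [compensator_of_stopped T R hKs hKk, compensator_of_running T R he K hKr, h1] at hY
    have := meanTime_mono hKk hk
    linarith
  · have hr : ∀ j ≤ k, (chain θ T R j).stopped = false := fun j hj => hKr j (by omega)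
    rw [compensator_of_running T R he k fun j hj => hr j hj.le] at hY
    have h1 := card_aliveB_of_running hinj hT R he k (hr k le_rfl)
    have h2 := Finset.card_le_card (aliveB_anti θ T (hY.trans ht))
    omega

/-- If the `k`-th death is not early and the process has enough balls of type `A`, then it does not
stop before `t`. -/
theorem lt_tau_of {T : Ball d → ℝ} (hinj : Function.Injective T) (hT : ∀ b, 0 < T b)
    (R : ℕ → Selector (Ball d)) (he : Even (∑ i, d i)) {k : ℕ} {t η : ℝ}
    (hY : compensator θ T R k - η ≤ (chain θ T R k).time)
    (ht : t < meanTime (∑ i, d i) k - η)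
    (hB : ∀ u ∈ Set.Icc 0 t, ∀ j < k, meanTime (∑ i, d i) j ≤ u + η →
      (aliveB θ T u).card + 2 * j < ∑ i, d i) : t < tau θ T R := by
  obtain ⟨K, hKs, hKr, htau⟩ := exists_tau_eq (θ := θ) T R he fun b => (hT b).le
  have hmono := chain_time_mono (θ := θ) T R fun b => (hT b).le
  have h0 : (chain θ T R 0).time = 0 := by simp [chain, recolour_time]
  have hnn : 0 ≤ (chain θ T R K).time := by
    have := hmono (Nat.zero_le K); simp only [h0] at this; exact this
  rw [htau]
  by_contra! hcon
  -- Freezing again transfers the bound from index `k` to index `K`, so `hB` applies at the stopping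
  -- time itself and contradicts the equality there.
  by_cases hKk : K < k
  · have h1 := chain_stopped_mono T R hKk.le hKs
    rw [compensator_of_stopped T R hKs hKk.le, compensator_of_running T R he K hKr, h1] at hY
    have h2 := hB _ ⟨hnn, hcon⟩ K hKk (by linarith)
    have h3 := card_aliveB_of_stopped hinj hT R he K hKr hKs
    omega
  · push Not at hKk
    rw [compensator_of_running T R he k fun j hj => hKr j (by omega)] at hY
    have := hmono hKk
    simp only at this
    linarith

end Deterministic

/-! ### The exponential law: memorylessness and a moment bound. -/

section Exponential

theorem expMeasure_one_eq : expMeasure 1 = volume.withDensity (exponentialPDF 1) := rfl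

instance isProbabilityMeasure_expMeasure_one : IsProbabilityMeasure (expMeasure 1) :=
  isProbabilityMeasure_expMeasure one_pos

theorem measurable_exponentialPDF (r : ℝ) : Measurable (exponentialPDF r) :=
  (measurable_exponentialPDFReal r).ennreal_ofReal

theorem expMeasure_one_singleton (x : ℝ) : expMeasure 1 {x} = 0 :=
  withDensity_absolutelyContinuous _ _ (measure_singleton x)

theorem lintegral_expMeasure_one {f : ℝ → ENNReal} (hf : Measurable f) :
    ∫⁻ x, f x ∂(expMeasure 1) = ∫⁻ x in Set.Ioi 0, ENNReal.ofReal (Real.exp (-x)) * f x := by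
  rw [expMeasure_one_eq, lintegral_withDensity_eq_lintegral_mul _ (measurable_exponentialPDF 1) hf,
    ← lintegral_indicator measurableSet_Ioi]
  refine lintegral_congr_ae ?_
  have h0 : ∀ᵐ x : ℝ, x ≠ 0 := by simp [ae_iff, measure_singleton]
  filter_upwards [h0] with x hx
  rcases lt_or_gt_of_ne hx with h | h
  · simp [exponentialPDF_of_neg h, Set.indicator, h.le]
  · simp [exponentialPDF_of_nonneg h.le, Set.indicator, h]

theorem ae_pos_expMeasure_one : ∀ᵐ x ∂(expMeasure 1), 0 < x := by
  have h := lintegral_expMeasure_one (f := (Set.Iic (0 : ℝ)).indicator 1)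
    (measurable_one.indicator measurableSet_Iic)
  rw [lintegral_indicator_one measurableSet_Iic] at h
  have h2 : ∫⁻ x in Set.Ioi (0 : ℝ), ENNReal.ofReal (Real.exp (-x)) *
      (Set.Iic (0 : ℝ)).indicator 1 x = 0 := by
    rw [setLIntegral_congr_fun measurableSet_Ioi (g := fun _ => 0)]
    · simp
    · intro x hx
      have hx : 0 < x := hx
      simp [hx]
  rw [h2] at h
  rw [ae_iff]
  simpa [Set.Iic, not_lt] using h

theorem map_sub_restrict_expMeasure {x : ℝ} (hx : 0 ≤ x) :
    ((expMeasure 1).restrict (Set.Ioi x)).map (fun y => y - x)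
      = ENNReal.ofReal (Real.exp (-x)) • expMeasure 1 := by
  ext s hs
  have hm : Measurable fun y : ℝ => y - x := measurable_id.sub_const x
  rw [Measure.map_apply hm hs, Measure.restrict_apply (hm hs), Measure.smul_apply, smul_eq_mul,
    ← lintegral_indicator_one ((hm hs).inter measurableSet_Ioi), ← lintegral_indicator_one hs,
    lintegral_expMeasure_one (measurable_one.indicator ((hm hs).inter measurableSet_Ioi)),
    lintegral_expMeasure_one (measurable_one.indicator hs),
    ← lintegral_const_mul _ (by
      exact (Real.measurable_exp.comp measurable_neg).ennreal_ofReal.mul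
        (measurable_one.indicator hs)),
    ← lintegral_indicator measurableSet_Ioi, ← lintegral_indicator measurableSet_Ioi,
    ← lintegral_add_right_eq_self _ x]
  refine lintegral_congr fun y => ?_
  by_cases hy : 0 < y
  · have hyx : 0 < y + x := by linarith
    by_cases hys : y ∈ s
    · simp only [Set.indicator, Set.mem_Ioi, hyx, hy, hys, Set.mem_inter_iff, Set.mem_preimage,
        add_sub_cancel_right, lt_add_iff_pos_left, and_self, if_true, Pi.one_apply, mul_one]
      rw [← ENNReal.ofReal_mul (Real.exp_pos _).le, ← Real.exp_add]
      congr 2; ring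
    · simp [Set.indicator, hys]
  · simp [Set.indicator, hy]

theorem lintegral_exp_neg_mul {r : ℝ} (hr : 0 < r) :
    ∫⁻ x in Set.Ioi (0 : ℝ), ENNReal.ofReal (Real.exp (-(r * x))) = ENNReal.ofReal (1 / r) := by
  have hneg : -r < 0 := by linarith
  have h1 : IntegrableOn (fun x : ℝ => Real.exp (-r * x)) (Set.Ioi 0) :=
    integrableOn_exp_mul_Ioi hneg 0
  have h2 := integral_exp_mul_Ioi hneg 0
  simp only [← neg_mul]
  rw [← ofReal_integral_eq_lintegral_ofReal h1 (Eventually.of_forall fun x => (Real.exp_pos _).le),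
    h2]
  congr 1
  simp

/-- The moment generating function of a centred exponential variable with rate `v`. -/
theorem lintegral_centred_exp_le {v s : ℝ} (hv : 0 < v) (hs : 2 * s ≤ v) :
    ENNReal.ofReal v * ∫⁻ x in Set.Ioi (0 : ℝ), ENNReal.ofReal (Real.exp (-(v * x))) *
      ENNReal.ofReal (Real.exp (s * (x - 1 / v))) ≤ ENNReal.ofReal (Real.exp (2 * (s / v) ^ 2)) := by
  have hvs : 0 < v - s := by linarith
  have h1 : ∀ x : ℝ, ENNReal.ofReal (Real.exp (-(v * x))) *
      ENNReal.ofReal (Real.exp (s * (x - 1 / v))) =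
      ENNReal.ofReal (Real.exp (-(s / v))) * ENNReal.ofReal (Real.exp (-((v - s) * x))) := by
    intro x
    rw [← ENNReal.ofReal_mul (Real.exp_pos _).le, ← ENNReal.ofReal_mul (Real.exp_pos _).le,
      ← Real.exp_add, ← Real.exp_add]
    congr 2
    ring
  simp only [h1]
  rw [lintegral_const_mul _ (by fun_prop), lintegral_exp_neg_mul hvs,
    ← ENNReal.ofReal_mul (Real.exp_pos _).le, ← ENNReal.ofReal_mul hv.le]
  refine ENNReal.ofReal_le_ofReal ?_
  set y := s / v with hy
  have hsy : s = y * v := by rw [hy]; field_simp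
  have hy2 : y ≤ 1 / 2 := by rw [hy, div_le_iff₀ hv]; linarith
  have h2 : v * (Real.exp (-y) * (1 / (v - s))) = Real.exp (-y) * (1 / (1 - y)) := by
    have : 1 - y ≠ 0 := by linarith
    rw [hsy, show v - y * v = v * (1 - y) by ring]
    field_simp
  rw [h2]
  -- Here `(1 - y) (1 + y + 2y²) = 1 + y² (1 - 2y) ≥ 1`, since `y ≤ 1/2`.
  have h3 : 1 / (1 - y) ≤ Real.exp (y + 2 * y ^ 2) := by
    refine le_trans ?_ (Real.add_one_le_exp _)
    rw [div_le_iff₀ (by linarith)]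
    nlinarith [mul_nonneg (sq_nonneg y) (by linarith : 0 ≤ 1 - 2 * y)]
  calc Real.exp (-y) * (1 / (1 - y)) ≤ Real.exp (-y) * Real.exp (y + 2 * y ^ 2) := by gcongr
    _ = Real.exp (2 * y ^ 2) := by rw [← Real.exp_add]; congr 1; ring

end Exponential

/-! ### Independent exponential lifetimes. -/

section Lifetimes

theorem measurable_update_snd {β : Type*} [DecidableEq β] (c : β) :
    Measurable fun q : ℝ × (β → ℝ) => Function.update q.2 c q.1 := by
  refine measurable_pi_iff.2 fun b => ?_
  by_cases h : b = c
  · subst h; simpa using measurable_fst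
  · simp only [Function.update_of_ne h]; exact (measurable_pi_apply b).comp measurable_snd

variable {β : Type*} [Fintype β]

/-- The law of independent exponential lifetimes with mean `1`. -/
def lifeLaw (β : Type*) [Fintype β] : Measure (β → ℝ) := Measure.pi fun _ => expMeasure 1

instance : IsProbabilityMeasure (lifeLaw β) := by unfold lifeLaw; infer_instance

theorem lifeLaw_map_eval (b : β) : (lifeLaw β).map (fun T => T b) = expMeasure 1 :=
  (measurePreserving_eval (fun _ : β => expMeasure 1) b).map_eq

theorem ae_pos_lifeLaw : ∀ᵐ T ∂(lifeLaw β), ∀ b, 0 < T b := by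
  rw [ae_all_iff]
  intro b
  have h := ae_pos_expMeasure_one
  rw [← lifeLaw_map_eval b] at h
  exact ae_of_ae_map (measurable_pi_apply b).aemeasurable h

variable [DecidableEq β]

/-- Resampling one coordinate preserves a product law. This permits integrating first over the other
lifetimes and then over that of a chosen ball `c`, a candidate for the first death. -/
theorem map_update_lifeLaw (c : β) :
    ((expMeasure 1).prod (lifeLaw β)).map (fun q => Function.update q.2 c q.1) = lifeLaw β := by
  symm
  refine Measure.pi_eq fun s hs => ?_
  rw [Measure.map_apply (measurable_update_snd c) (MeasurableSet.univ_pi hs)]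
  have hpre : (fun q : ℝ × (β → ℝ) => Function.update q.2 c q.1) ⁻¹' Set.univ.pi s =
      s c ×ˢ Set.univ.pi (Function.update s c Set.univ) := by
    ext q
    simp only [Set.mem_preimage, Set.mem_pi, Set.mem_univ, true_implies, Set.mem_prod]
    constructor
    · intro h
      refine ⟨by simpa using h c, fun b => ?_⟩
      by_cases hb : b = c
      · subst hb; simp
      · simpa [Function.update_of_ne hb] using h b
    · rintro ⟨h1, h2⟩ b
      by_cases hb : b = c
      · subst hb; simpa using h1
      · simpa [Function.update_of_ne hb] using h2 b
  rw [hpre, Measure.prod_prod, lifeLaw, Measure.pi_pi,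
    ← Finset.mul_prod_erase Finset.univ (fun i => expMeasure 1 (s i)) (Finset.mem_univ c),
    ← Finset.mul_prod_erase Finset.univ (fun i => expMeasure 1 (Function.update s c Set.univ i))
      (Finset.mem_univ c)]
  simp only [Function.update_self, measure_univ, one_mul]
  congr 1
  refine Finset.prod_congr rfl fun b hb => ?_
  rw [Function.update_of_ne (Finset.ne_of_mem_erase hb)]

theorem lintegral_lifeLaw_update (c : β) {f : (β → ℝ) → ENNReal} (hf : Measurable f) :
    ∫⁻ T, f T ∂(lifeLaw β) =
      ∫⁻ x, ∫⁻ T, f (Function.update T c x) ∂(lifeLaw β) ∂(expMeasure 1) := by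
  conv_lhs => rw [← map_update_lifeLaw c]
  rw [lintegral_map hf (measurable_update_snd c),
    lintegral_prod (fun q : ℝ × (β → ℝ) => f (Function.update q.2 c q.1))
      (hf.comp (measurable_update_snd c)).aemeasurable]

/-- With all other lifetimes fixed, a tie requires the resampled lifetime to hit a single value,
which has probability zero. -/
theorem ae_injective_lifeLaw : ∀ᵐ T ∂(lifeLaw β), Function.Injective T := by
  have h : ∀ b c : β, b ≠ c → ∀ᵐ T ∂(lifeLaw β), T b ≠ T c := by
    intro b c hbc
    have hms : MeasurableSet {T : β → ℝ | T b = T c} :=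
      measurableSet_eq_fun (measurable_pi_apply b) (measurable_pi_apply c)
    rw [ae_iff]
    simp only [ne_eq, not_not]
    rw [← lintegral_indicator_one hms, lintegral_lifeLaw_update c
      (measurable_one.indicator hms), ← lintegral_lintegral_swap]
    · refine lintegral_eq_zero_of_ae_eq_zero (Eventually.of_forall fun T => ?_)
      have : ∀ x, Set.indicator {T : β → ℝ | T b = T c} (1 : (β → ℝ) → ENNReal)
          (Function.update T c x) = ({T b} : Set ℝ).indicator 1 x := by
        intro x
        simp [Set.indicator, Function.update_of_ne hbc, eq_comm]
      simp only [this]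
      rw [lintegral_indicator_one (measurableSet_singleton _)]
      exact expMeasure_one_singleton _
    · exact ((measurable_one.indicator hms).comp
        ((measurable_update_snd c).comp measurable_swap)).aemeasurable
  have h2 : ∀ᵐ T ∂(lifeLaw β), ∀ b c : β, b ≠ c → T b ≠ T c := by
    simp only [ae_all_iff]
    exact h
  filter_upwards [h2] with T hT b c hbc
  by_contra hne
  exact hT b c hne hbc

/-- The memoryless property of the exponential lifetimes. -/
theorem lintegral_residual (W : Finset β) {x : ℝ} (hx : 0 ≤ x) {F : (β → ℝ) → ENNReal}
    (hF : Measurable F) :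
    ∫⁻ T, (Set.univ.pi fun b => if b ∈ W then Set.Ioi x else Set.univ).indicator
      (fun T => F fun b => if b ∈ W then T b - x else T b) T ∂(lifeLaw β)
      = ENNReal.ofReal (Real.exp (-x)) ^ W.card * ∫⁻ T, F T ∂(lifeLaw β) := by
  have hms : ∀ b, MeasurableSet (if b ∈ W then Set.Ioi x else Set.univ : Set ℝ) := by
    intro b; split_ifs
    · exact measurableSet_Ioi
    · exact MeasurableSet.univ
  have hmap : ∀ b, Measurable fun y : ℝ => if b ∈ W then y - x else y := by
    intro b; split_ifs
    · exact measurable_id.sub_const x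
    · exact measurable_id
  rw [lintegral_indicator (MeasurableSet.univ_pi hms)]
  have hG : Measurable fun (T : β → ℝ) b => if b ∈ W then T b - x else T b :=
    measurable_pi_iff.2 fun b => (hmap b).comp (measurable_pi_apply b)
  rw [← lintegral_map hF hG]
  have key : ((lifeLaw β).restrict (Set.univ.pi fun b => if b ∈ W then Set.Ioi x else Set.univ)).map
      (fun (T : β → ℝ) b => if b ∈ W then T b - x else T b)
      = ENNReal.ofReal (Real.exp (-x)) ^ W.card • lifeLaw β := by
    rw [lifeLaw, Measure.restrict_pi_pi, Measure.pi_map_pi fun b => (hmap b).aemeasurable]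
    have hmeas : ∀ b, ((expMeasure 1).restrict (if b ∈ W then Set.Ioi x else Set.univ)).map
        (fun y : ℝ => if b ∈ W then y - x else y) =
        (if b ∈ W then ENNReal.ofReal (Real.exp (-x)) else 1) • expMeasure 1 := by
      intro b
      by_cases h : b ∈ W
      · simp only [h, if_true]; exact map_sub_restrict_expMeasure hx
      · simp [h]
    simp only [hmeas]
    have hfin : ∀ b, SigmaFinite
        ((if b ∈ W then ENNReal.ofReal (Real.exp (-x)) else 1) • expMeasure 1) := by
      intro b
      have : IsFiniteMeasure
        ((if b ∈ W then ENNReal.ofReal (Real.exp (-x)) else 1) • expMeasure 1) := by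
        refine ⟨?_⟩
        rw [Measure.smul_apply, measure_univ]
        split_ifs <;> simp
      infer_instance
    refine Measure.pi_eq fun s hs => ?_
    simp only [Measure.smul_apply, smul_eq_mul, Measure.pi_pi]
    rw [Finset.prod_mul_distrib]
    congr 1
    rw [Finset.prod_ite_mem]
    simp
  rw [key, lintegral_smul_measure, smul_eq_mul]

end Lifetimes

/-! ### The first death among a set of balls and the residual lifetimes. -/

section FirstDeath

variable {n : ℕ} {d : Fin n → ℕ}

instance : DiscreteMeasurableSpace (Ball d) := by
  refine ⟨fun s => ?_⟩
  simp only [MeasurableSpace.measurableSet_iInf]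
  intro i
  exact MeasurableSet.of_discrete (s := Sigma.mk i ⁻¹' s)

/-- `firstDeath` is a choice among minimisers, and equal sets of minimisers give the same choice,
ties included. It thus depends only on the order pattern of the lifetimes, which takes finitely many
values; this yields shift invariance and measurability. -/
theorem firstDeath_congr {T T' : Ball d → ℝ} {V : Finset (Ball d)} (h : V.Nonempty)
    (hTT : ∀ b ∈ V, ∀ c ∈ V, (T b ≤ T c ↔ T' b ≤ T' c)) :
    firstDeath T V h = firstDeath T' V h := by
  have hp : (fun x => x ∈ V ∧ ∀ x' ∈ V, T x ≤ T x') = fun x => x ∈ V ∧ ∀ x' ∈ V, T' x ≤ T' x' := by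
    funext x
    refine propext (and_congr_right fun hx => forall₂_congr fun y hy => hTT x hx y hy)
  unfold firstDeath
  congr!

theorem firstDeath_sub (T : Ball d → ℝ) (t : ℝ) {V : Finset (Ball d)} (h : V.Nonempty) :
    firstDeath (fun b => T b - t) V h = firstDeath T V h :=
  firstDeath_congr h fun b _ c _ => by simp

theorem measurable_firstDeath {V : Finset (Ball d)} (h : V.Nonempty) :
    Measurable fun T : Ball d → ℝ => firstDeath T V h := by
  classical
  let pat : (Ball d → ℝ) → (Ball d → Ball d → Bool) := fun T b c => decide (T b ≤ T c)
  have hpat : Measurable pat := by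
    refine measurable_pi_iff.2 fun b => measurable_pi_iff.2 fun c => ?_
    refine measurable_to_bool ?_
    have : (fun T : Ball d → ℝ => pat T b c) ⁻¹' {true} = {T | T b ≤ T c} := by
      ext T; simp [pat]
    rw [this]
    exact measurableSet_le (measurable_pi_apply b) (measurable_pi_apply c)
  have hfac : ∃ g : (Ball d → Ball d → Bool) → Ball d,
      (fun T : Ball d → ℝ => firstDeath T V h) = g ∘ pat := by
    refine ⟨fun q => if hq : ∃ T, pat T = q then firstDeath hq.choose V h else h.choose, ?_⟩
    funext T
    have hq : ∃ T', pat T' = pat T := ⟨T, rfl⟩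
    simp only [Function.comp, dif_pos hq]
    refine firstDeath_congr h fun b _ c _ => ?_
    have := congrFun (congrFun hq.choose_spec b) c
    simp only [pat, decide_eq_decide] at this
    exact this.symm
  obtain ⟨g, hg⟩ := hfac
  rw [hg]
  exact (measurable_of_finite g).comp hpat

theorem measurable_apply_firstDeath {γ : Type*} [MeasurableSpace γ] {V : Finset (Ball d)}
    (h : V.Nonempty) {g : Ball d → (Ball d → ℝ) → γ} (hg : ∀ c, Measurable (g c)) :
    Measurable fun T : Ball d → ℝ => g (firstDeath T V h) T := by
  have : Measurable fun q : Ball d × (Ball d → ℝ) => g q.1 q.2 :=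
    measurable_from_prod_countable_right fun c => hg c
  exact this.comp ((measurable_firstDeath h).prodMk measurable_id)

/-- Given the first death, the residual lifetimes of the other balls are independent exponential
variables, independent of the time of the first death. -/
theorem lintegral_firstDeath_le {V : Finset (Ball d)} (hV : V.Nonempty) {φ : ℝ → ENNReal}
    (hφ : Measurable φ) {F : Ball d → (Ball d → ℝ) → ENNReal} (hF : ∀ c, Measurable (F c))
    (hloc : ∀ c ∈ V, ∀ T T' : Ball d → ℝ, (∀ b ∈ V.erase c, T b = T' b) → F c T = F c T')
    {C : ENNReal} (hC : ∀ c ∈ V, ∫⁻ T, F c T ∂(lifeLaw (Ball d)) ≤ C) :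
    ∫⁻ T, φ (T (firstDeath T V hV)) * F (firstDeath T V hV)
        (fun b => T b - T (firstDeath T V hV)) ∂(lifeLaw (Ball d)) ≤
      (V.card * ∫⁻ x in Set.Ioi (0 : ℝ), ENNReal.ofReal (Real.exp (-(V.card * x))) * φ x) * C := by
  classical
  -- `A c` is the event that `c` is the strict first death. As ties are null, these events cover
  -- almost every outcome, and the integral is split along them.
  let A : Ball d → Set (Ball d → ℝ) := fun c => {T | ∀ b ∈ V.erase c, T c < T b}
  have hA : ∀ c, MeasurableSet (A c) := by
    intro c
    have : A c = ⋂ b ∈ V.erase c, {T : Ball d → ℝ | T c < T b} := by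
      ext T; simp [A]
    rw [this]
    exact Finset.measurableSet_biInter _ fun b _ =>
      measurableSet_lt (measurable_pi_apply c) (measurable_pi_apply b)
  let H : Ball d → (Ball d → ℝ) → ENNReal := fun c T => φ (T c) * F c (fun b => T b - T c)
  have hH : ∀ c, Measurable (H c) := by
    intro c
    refine (hφ.comp (measurable_pi_apply c)).mul ((hF c).comp ?_)
    exact measurable_pi_iff.2 fun b => (measurable_pi_apply b).sub (measurable_pi_apply c)
  have hstep : ∀ c ∈ V, ∫⁻ T, (A c).indicator (H c) T ∂(lifeLaw (Ball d)) ≤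
      (∫⁻ x in Set.Ioi (0 : ℝ), ENNReal.ofReal (Real.exp (-(V.card * x))) * φ x) * C := by
    intro c hc
    rw [lintegral_lifeLaw_update c ((hH c).indicator (hA c))]
    have hinner : ∀ x : ℝ, 0 < x → ∫⁻ T, (A c).indicator (H c) (Function.update T c x)
        ∂(lifeLaw (Ball d)) ≤
        φ x * (ENNReal.ofReal (Real.exp (-x)) ^ (V.erase c).card * C) := by
      intro x hx
      -- `H c` shifts every coordinate by `x`, whereas memorylessness applies only to the balls
      -- conditioned to outlive `x`; `hloc` says that the other coordinates do not matter.
      have h1 : ∀ T : Ball d → ℝ, (A c).indicator (H c) (Function.update T c x) = φ x *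
          (Set.univ.pi fun b => if b ∈ V.erase c then Set.Ioi x else Set.univ).indicator
          (fun T => F c fun b => if b ∈ V.erase c then T b - x else T b) T := by
        intro T
        have hmem : Function.update T c x ∈ A c ↔
            T ∈ (Set.univ.pi fun b => if b ∈ V.erase c then Set.Ioi x else Set.univ) := by
          simp only [A, Set.mem_ofPred_eq, Set.mem_pi, Set.mem_univ, true_implies]
          refine forall_congr' fun b => ?_
          by_cases hb : b ∈ V.erase c
          · simp only [hb, true_implies, if_true, Set.mem_Ioi, Function.update_self]
            rw [Function.update_of_ne (Finset.ne_of_mem_erase hb)]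
          · simp [hb]
        by_cases hT : Function.update T c x ∈ A c
        · rw [Set.indicator_of_mem hT, Set.indicator_of_mem (hmem.1 hT)]
          simp only [H, Function.update_self]
          congr 1
          refine hloc c hc _ _ fun b hb => ?_
          rw [if_pos hb, Function.update_of_ne (Finset.ne_of_mem_erase hb)]
        · rw [Set.indicator_of_notMem hT, Set.indicator_of_notMem (fun h => hT (hmem.2 h)), mul_zero]
      simp only [h1]
      have hms : ∀ b, MeasurableSet (if b ∈ V.erase c then Set.Ioi x else Set.univ : Set ℝ) := by
        intro b; split_ifs
        · exact measurableSet_Ioi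
        · exact MeasurableSet.univ
      have hmm : Measurable fun T : Ball d → ℝ =>
          F c fun b => if b ∈ V.erase c then T b - x else T b := by
        refine (hF c).comp (measurable_pi_iff.2 fun b => ?_)
        split_ifs
        · exact Measurable.sub_const (f := fun T : Ball d → ℝ => T b) (measurable_pi_apply b) x
        · exact measurable_pi_apply b
      rw [lintegral_const_mul _ (hmm.indicator (MeasurableSet.univ_pi hms)),
        lintegral_residual _ hx.le (hF c)]
      gcongr
      exact hC c hc
    calc ∫⁻ x, ∫⁻ T, (A c).indicator (H c) (Function.update T c x)
            ∂(lifeLaw (Ball d)) ∂(expMeasure 1)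
        ≤ ∫⁻ x, φ x * (ENNReal.ofReal (Real.exp (-x)) ^ (V.erase c).card * C) ∂(expMeasure 1) := by
          refine lintegral_mono_ae ?_
          filter_upwards [ae_pos_expMeasure_one] with x hx using hinner x hx
      _ = ∫⁻ x in Set.Ioi 0, ENNReal.ofReal (Real.exp (-x)) *
            (φ x * (ENNReal.ofReal (Real.exp (-x)) ^ (V.erase c).card * C)) := by
          refine lintegral_expMeasure_one (hφ.mul (Measurable.mul_const ?_ _))
          exact (Real.measurable_exp.comp measurable_neg).ennreal_ofReal.pow_const _
      _ = ∫⁻ x in Set.Ioi 0, (ENNReal.ofReal (Real.exp (-(V.card * x))) * φ x) * C := by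
          refine lintegral_congr fun x => ?_
          -- One factor is the density of the lifetime of `c`, the others are the survival
          -- probabilities of the remaining balls of `V`.
          have : ENNReal.ofReal (Real.exp (-(V.card * x))) =
              ENNReal.ofReal (Real.exp (-x)) * ENNReal.ofReal (Real.exp (-x)) ^
                (V.erase c).card := by
            rw [← pow_succ', Finset.card_erase_add_one hc,
              ← ENNReal.ofReal_pow (Real.exp_pos _).le, ← Real.exp_nat_mul]
            congr 2; ring
          rw [this]; ring
      _ = _ := by
          refine lintegral_mul_const _ (Measurable.mul ?_ hφ)
          fun_prop
  calc ∫⁻ T, φ (T (firstDeath T V hV)) * F (firstDeath T V hV)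
        (fun b => T b - T (firstDeath T V hV)) ∂(lifeLaw (Ball d))
      ≤ ∫⁻ T, ∑ c ∈ V, (A c).indicator (H c) T ∂(lifeLaw (Ball d)) := by
        refine lintegral_mono_ae ?_
        filter_upwards [ae_injective_lifeLaw] with T hT
        have hmem : T ∈ A (firstDeath T V hV) := fun b hb =>
          lt_of_le_of_ne (firstDeath_le T V hV (Finset.mem_of_mem_erase hb)) fun he =>
            Finset.ne_of_mem_erase hb (hT he).symm
        refine le_trans ?_ (Finset.single_le_sum (f := fun c => (A c).indicator (H c) T)
          (fun _ _ => zero_le) (firstDeath_mem T V hV))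
        simp only [Set.indicator_of_mem hmem, H, le_refl]
    _ = ∑ c ∈ V, ∫⁻ T, (A c).indicator (H c) T ∂(lifeLaw (Ball d)) :=
        lintegral_finsetSum _ fun c _ => (hH c).indicator (hA c)
    _ ≤ ∑ c ∈ V, (∫⁻ x in Set.Ioi (0 : ℝ),
          ENNReal.ofReal (Real.exp (-(V.card * x))) * φ x) * C := Finset.sum_le_sum hstep
    _ = _ := by rw [Finset.sum_const, nsmul_eq_mul, mul_assoc]

end FirstDeath

/-! ### Exponential moments of the centred death times, for fixed choices. -/

section ExponentialMoment

variable {n : ℕ} {d : Fin n → ℕ} (θ : Fin n → ℕ)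

/-- The exponential, with parameter `s`, of the sum of the centred waiting times for the first `k`
deaths, when `V` is the set of white balls at first. -/
def expWait (s : ℝ) : ℕ → (ℕ → Selector (Ball d)) → Finset (Ball d) → (Ball d → ℝ) → ℝ
  | 0, _, _, _ => 1
  | k + 1, R, V, T =>
    if hV : V.Nonempty then
      Real.exp (s * (T (firstDeath T V hV) - 1 / (V.card : ℝ))) *
        if (recolour d θ (R 0) (V.erase (firstDeath T V hV)) 0).stopped then 1
        else expWait s k (fun j => R (j + 1))
          (recolour d θ (R 0) (V.erase (firstDeath T V hV)) 0).white
          (fun b => T b - T (firstDeath T V hV))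
    else 1

/-- This is the locality hypothesis `hloc` of `lintegral_firstDeath_le`, needed for the induction on
the number of deaths. -/
theorem expWait_congr (s : ℝ) (k : ℕ) (R : ℕ → Selector (Ball d)) (V : Finset (Ball d))
    (T T' : Ball d → ℝ) (h : ∀ b ∈ V, T b = T' b) :
    expWait θ s k R V T = expWait θ s k R V T' := by
  induction k generalizing R V T T' with
  | zero => rfl
  | succ k ih =>
    by_cases hV : V.Nonempty
    · have hfd : firstDeath T V hV = firstDeath T' V hV :=
        firstDeath_congr hV fun b hb c hc => by rw [h b hb, h c hc]
      simp only [expWait, dif_pos hV]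
      rw [hfd, h _ (firstDeath_mem T' V hV)]
      congr 1
      split_ifs with hs
      · rfl
      · refine ih _ _ _ _ fun b hb => ?_
        rw [h b (Finset.mem_of_mem_erase ((recolour_card θ _ _ _ (by simpa using hs)).2 hb))]
    · simp only [expWait, dif_neg hV]

theorem measurable_expWait (s : ℝ) (k : ℕ) (R : ℕ → Selector (Ball d)) (V : Finset (Ball d)) :
    Measurable (expWait θ s k R V) := by
  induction k generalizing R V with
  | zero => exact measurable_const
  | succ k ih =>
    by_cases hV : V.Nonempty
    · let g : Ball d → (Ball d → ℝ) → ℝ := fun c T =>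
          Real.exp (s * (T c - 1 / (V.card : ℝ))) *
            if (recolour d θ (R 0) (V.erase c) 0).stopped then 1
            else expWait θ s k (fun j => R (j + 1)) (recolour d θ (R 0) (V.erase c) 0).white
              (fun b => T b - T c)
      have : expWait θ s (k + 1) R V = fun T => g (firstDeath T V hV) T := by
        funext T; simp only [expWait, dif_pos hV, g]
      rw [this]
      refine measurable_apply_firstDeath hV fun c => ?_
      have hc : Measurable fun T : Ball d → ℝ => T c := measurable_pi_apply c
      refine Measurable.mul (by fun_prop) ?_
      split_ifs
      · exact measurable_const
      · exact (ih _ _).comp (measurable_pi_iff.2 fun b => (measurable_pi_apply b).sub hc)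
    · have : expWait θ s (k + 1) R V = fun _ => 1 := by
        funext T; simp only [expWait, dif_neg hV]
      rw [this]
      exact measurable_const

/-- After the first death the residual lifetimes are fresh, so the moment factorises round by round.
Each round removes two white balls, so at least `w` are white at every waiting time involved and
each factor is at most `exp (2 (s / w)²)`. -/
theorem lintegral_expWait_le {s w : ℝ} (hw : 0 < w) (hs : 2 * s ≤ w) (k : ℕ)
    (R : ℕ → Selector (Ball d)) (V : Finset (Ball d)) (hV : w + 2 * k ≤ V.card) :
    ∫⁻ T, ENNReal.ofReal (expWait θ s k R V T) ∂(lifeLaw (Ball d)) ≤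
      ENNReal.ofReal (Real.exp (2 * (s / w) ^ 2)) ^ k := by
  induction k generalizing R V with
  | zero => simp [expWait]
  | succ k ih =>
    push_cast at hV
    have hk : (0 : ℝ) ≤ k := k.cast_nonneg
    have hVpos : (0 : ℝ) < V.card := by linarith
    have hne : V.Nonempty := Finset.card_pos.1 (by exact_mod_cast hVpos)
    let F : Ball d → (Ball d → ℝ) → ENNReal := fun c T => ENNReal.ofReal
      (if (recolour d θ (R 0) (V.erase c) 0).stopped then 1
        else expWait θ s k (fun j => R (j + 1)) (recolour d θ (R 0) (V.erase c) 0).white T)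
    have hF : ∀ c, Measurable (F c) := by
      intro c
      refine Measurable.ennreal_ofReal ?_
      split_ifs
      · exact measurable_const
      · exact measurable_expWait θ s k _ _
    have hone : (1 : ENNReal) ≤ ENNReal.ofReal (Real.exp (2 * (s / w) ^ 2)) ^ k := by
      refine one_le_pow₀ ?_
      rw [ENNReal.one_le_ofReal]
      exact Real.one_le_exp (by positivity)
    have hmain := lintegral_firstDeath_le hne
      (φ := fun x => ENNReal.ofReal (Real.exp (s * (x - 1 / (V.card : ℝ))))) (by fun_prop) hF
      (fun c hc T T' hTT => by
        simp only [F]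
        split_ifs with h
        · rfl
        · rw [expWait_congr θ s k _ _ T T' fun b hb =>
            hTT b ((recolour_card θ _ _ _ (by simpa using h)).2 hb)])
      (C := ENNReal.ofReal (Real.exp (2 * (s / w) ^ 2)) ^ k)
      (fun c hc => by
        simp only [F]
        split_ifs with h
        · simpa using hone
        · refine ih _ _ ?_
          have h1 := (recolour_card θ (R 0) (V.erase c) 0 (by simpa using h)).1
          have h2 := Finset.card_erase_add_one hc
          have h3 : ((recolour d θ (R 0) (V.erase c) 0).white.card : ℝ) + 2 = V.card := by
            exact_mod_cast (by omega :
              (recolour d θ (R 0) (V.erase c) 0).white.card + 2 = V.card)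
          linarith)
    refine le_trans (le_of_eq ?_) (hmain.trans ?_)
    · refine lintegral_congr fun T => ?_
      simp only [expWait, dif_pos hne, F]
      rw [ENNReal.ofReal_mul (Real.exp_pos _).le]
    · rw [pow_succ' _ k]
      refine mul_le_mul' ?_ le_rfl
      refine le_trans (le_of_eq ?_) ((lintegral_centred_exp_le (s := s) hVpos
        (by linarith)).trans ?_)
      · rw [ENNReal.ofReal_natCast]
      · refine ENNReal.ofReal_le_ofReal (Real.exp_le_exp.2 ?_)
        have hwV : w ≤ V.card := by linarith
        rw [div_pow, div_pow]
        gcongr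

/-- The process started from the state `s`. -/
def chainFrom (T : Ball d → ℝ) (R : ℕ → Selector (Ball d)) (s : State d) : ℕ → State d
  | 0 => s
  | k + 1 => step θ T (R k) (chainFrom T R s k)

variable {θ}

theorem chainFrom_succ (T : Ball d → ℝ) (R : ℕ → Selector (Ball d)) (s : State d) (k : ℕ) :
    chainFrom θ T R s (k + 1) = chainFrom θ T (fun j => R (j + 1)) (step θ T (R 0) s) k := by
  induction k with
  | zero => rfl
  | succ k ih => rw [chainFrom, ih]; rfl

theorem chain_eq_chainFrom (T : Ball d → ℝ) (R : ℕ → Selector (Ball d)) (k : ℕ) :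
    chain θ T R k = chainFrom θ T (fun j => R (j + 1)) (recolour d θ (R 0) Finset.univ 0) k := by
  induction k with
  | zero => rfl
  | succ k ih => rw [chain, ih]; rfl

theorem chainFrom_of_stopped (T : Ball d → ℝ) (R : ℕ → Selector (Ball d)) {s : State d}
    (hs : s.stopped = true ∨ s.white = ∅) (k : ℕ) : chainFrom θ T R s k = s := by
  induction k with
  | zero => rfl
  | succ k ih =>
    rw [chainFrom, ih, step]
    rcases hs with h | h
    · simp [h]
    · simp [h]

theorem recolour_congr_time (pick : Selector (Ball d)) (V : Finset (Ball d)) (t t' : ℝ) :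
    (recolour d θ pick V t).white = (recolour d θ pick V t').white ∧
      (recolour d θ pick V t).stopped = (recolour d θ pick V t').stopped := by
  unfold recolour
  split_ifs <;> simp

theorem recolour_eq_mk (pick : Selector (Ball d)) (V : Finset (Ball d)) (t : ℝ)
    (h : (recolour d θ pick V t).stopped = false) :
    recolour d θ pick V t = ⟨(recolour d θ pick V t).white, t, false⟩ := by
  unfold recolour at h ⊢
  split_ifs at h ⊢ with h1
  rfl

/-- Connects the recursion, which restarts the clock at each death, to the process, which keeps
absolute times: shifting all lifetimes by `t` corresponds to starting at time `t`. -/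
theorem expWait_eq (s : ℝ) (T : Ball d → ℝ) (k : ℕ) (R : ℕ → Selector (Ball d))
    (V : Finset (Ball d)) (t : ℝ) :
    expWait θ s k R V (fun b => T b - t) =
      Real.exp (s * ((chainFrom θ T R ⟨V, t, false⟩ k).time - t - ∑ j ∈ Finset.range k,
        if (chainFrom θ T R ⟨V, t, false⟩ j).stopped then 0 else
          1 / ((chainFrom θ T R ⟨V, t, false⟩ j).white.card : ℝ))) := by
  induction k generalizing R V t with
  | zero => simp [expWait, chainFrom]
  | succ k ih =>
    by_cases hV : V.Nonempty
    · set c := firstDeath T V hV with hc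
      have hstep : step θ T (R 0) ⟨V, t, false⟩ = recolour d θ (R 0) (V.erase c) (T c) := by
        simp [step, hV, hc]
      obtain ⟨hw, hst⟩ := recolour_congr_time (θ := θ) (R 0) (V.erase c) 0 (T c)
      rw [Finset.sum_range_succ']
      simp only [chainFrom_succ, hstep]
      simp only [expWait, dif_pos hV, firstDeath_sub, ← hc, hw, hst, sub_sub_sub_cancel_right]
      by_cases h : (recolour d θ (R 0) (V.erase c) (T c)).stopped = true
      · simp only [chainFrom_of_stopped T _ (Or.inl h), h, if_true, recolour_time, chainFrom]
        simp
      · have h' : recolour d θ (R 0) (V.erase c) (T c) =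
            ⟨(recolour d θ (R 0) (V.erase c) (T c)).white, T c, false⟩ :=
          recolour_eq_mk _ _ _ (by simpa using h)
        rw [if_neg h, ih, ← Real.exp_add, ← h']
        congr 1
        simp only [chainFrom]
        simp
        ring
    · rw [Finset.not_nonempty_iff_eq_empty] at hV
      subst hV
      simp only [chainFrom_of_stopped T R (s := ⟨∅, t, false⟩) (Or.inr rfl)]
      simp [expWait]

theorem expWait_eq_chain (s : ℝ) (T : Ball d → ℝ) (k : ℕ) (R : ℕ → Selector (Ball d))
    (h0 : (chain θ T R 0).stopped = false) :
    expWait θ s k (fun j => R (j + 1)) (chain θ T R 0).white T =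
      Real.exp (s * ((chain θ T R k).time - compensator θ T R k)) := by
  have h := expWait_eq (θ := θ) s T k (fun j => R (j + 1)) (chain θ T R 0).white 0
  have h' : (⟨(chain θ T R 0).white, 0, false⟩ : State d) =
      recolour d θ (R 0) Finset.univ 0 := (recolour_eq_mk _ _ _ h0).symm
  rw [h'] at h
  simp only [← chain_eq_chainFrom, sub_zero] at h
  exact h

end ExponentialMoment

/-! ### Concentration of the death times, for random choices. -/

section Waiting

variable {n : ℕ} {d : Fin n → ℕ} (θ : Fin n → ℕ)

/-- The centred time of the `k`-th death. -/
def centredTime (T : Ball d → ℝ) (R : ℕ → Selector (Ball d)) (k : ℕ) : ℝ :=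
  (chain θ T R k).time - compensator θ T R k

theorem centredTime_of_stopped (T : Ball d → ℝ) (R : ℕ → Selector (Ball d)) (k : ℕ)
    (h0 : (recolour d θ (R 0) Finset.univ 0).stopped = true) : centredTime θ T R k = 0 := by
  have h : (chain θ T R 0).stopped = true := h0
  rw [centredTime, compensator_of_stopped T R h (Nat.zero_le k),
    chain_stopped_mono T R (Nat.zero_le k) h]
  simp [compensator, chain, recolour_time]

theorem exp_centredTime (s : ℝ) (T : Ball d → ℝ) (R : ℕ → Selector (Ball d)) (k : ℕ)
    (h0 : (recolour d θ (R 0) Finset.univ 0).stopped = false) :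
    Real.exp (s * centredTime θ T R k) = expWait θ s k (fun j => R (j + 1))
      (recolour d θ (R 0) Finset.univ 0).white T :=
  (expWait_eq_chain s T k R h0).symm

theorem measurable_centredTime (R : ℕ → Selector (Ball d)) (k : ℕ) :
    Measurable fun T : Ball d → ℝ => centredTime θ T R k := by
  by_cases h0 : (recolour d θ (R 0) Finset.univ 0).stopped = true
  · simp only [centredTime_of_stopped θ _ R k h0]
    exact measurable_const
  · have h : (fun T : Ball d → ℝ => centredTime θ T R k) = fun T => Real.log
        (expWait θ 1 k (fun j => R (j + 1)) (recolour d θ (R 0) Finset.univ 0).white T) := by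
      funext T
      rw [← exp_centredTime θ 1 T R k (by simpa using h0), Real.log_exp, one_mul]
    rw [h]
    exact Real.measurable_log.comp (measurable_expWait θ 1 k _ _)

theorem lintegral_exp_centredTime_le {s w : ℝ} (hw : 0 < w) (hs : 2 * s ≤ w) (k : ℕ)
    (R : ℕ → Selector (Ball d)) (hM : w + 2 * k + 1 ≤ ∑ i, d i) :
    ∫⁻ T, ENNReal.ofReal (Real.exp (s * centredTime θ T R k)) ∂(lifeLaw (Ball d)) ≤
      ENNReal.ofReal (Real.exp (2 * k * (s / w) ^ 2)) := by
  have hc : Fintype.card (Ball d) = ∑ i, d i := by simp [Ball]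
  by_cases h0 : (recolour d θ (R 0) Finset.univ 0).stopped = true
  · simp only [centredTime_of_stopped θ _ R k h0, mul_zero, Real.exp_zero, ENNReal.ofReal_one,
      lintegral_const, measure_univ, mul_one]
    rw [ENNReal.one_le_ofReal]
    exact Real.one_le_exp (by positivity)
  · have h0' : (recolour d θ (R 0) Finset.univ 0).stopped = false := by simpa using h0
    simp only [exp_centredTime θ s _ R k h0']
    have h1 := (recolour_card θ (R 0) Finset.univ 0 h0').1
    rw [Finset.card_univ, hc] at h1
    refine (lintegral_expWait_le θ hw hs k _ _ ?_).trans (le_of_eq ?_)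
    · rw [← h1] at hM
      push_cast at hM
      linarith
    · rw [← ENNReal.ofReal_pow (Real.exp_pos _).le, ← Real.exp_nat_mul]
      congr 2; ring

/-- Chernoff's bound with the parameters `s` and `-s` for the two tails; the moment bound depends on
the parameter only through its square. -/
theorem lifeLaw_centredTime_le {s w η : ℝ} (hw : 0 < w) (hs0 : 0 < s) (hs : 2 * s ≤ w) (k : ℕ)
    (R : ℕ → Selector (Ball d)) (hM : w + 2 * k + 1 ≤ ∑ i, d i) :
    lifeLaw (Ball d) {T | η ≤ |centredTime θ T R k|} ≤
      2 * ENNReal.ofReal (Real.exp (2 * k * (s / w) ^ 2 - s * η)) := by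
  have hside : ∀ r : ℝ, 2 * r ≤ w → r ^ 2 = s ^ 2 →
      lifeLaw (Ball d) {T | s * η ≤ r * centredTime θ T R k} ≤
        ENNReal.ofReal (Real.exp (2 * k * (s / w) ^ 2 - s * η)) := by
    intro r hr hrs
    have hmeas : Measurable fun T : Ball d → ℝ =>
        ENNReal.ofReal (Real.exp (r * centredTime θ T R k)) :=
      (Real.measurable_exp.comp ((measurable_centredTime θ R k).const_mul r)).ennreal_ofReal
    have hsub : {T : Ball d → ℝ | s * η ≤ r * centredTime θ T R k} ⊆
        {T | ENNReal.ofReal (Real.exp (s * η)) ≤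
          ENNReal.ofReal (Real.exp (r * centredTime θ T R k))} := by
      intro T hT
      exact ENNReal.ofReal_le_ofReal (Real.exp_le_exp.2 hT)
    refine (measure_mono hsub).trans ((meas_ge_le_lintegral_div hmeas.aemeasurable ?_ ?_).trans ?_)
    · simp [Real.exp_pos]
    · exact ENNReal.ofReal_ne_top
    · refine (ENNReal.div_le_div_right (lintegral_exp_centredTime_le θ hw hr k R hM) _).trans ?_
      rw [← ENNReal.ofReal_div_of_pos (Real.exp_pos _), ← Real.exp_sub, div_pow, div_pow, hrs]
  have hsub : {T : Ball d → ℝ | η ≤ |centredTime θ T R k|} ⊆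
      {T | s * η ≤ s * centredTime θ T R k} ∪ {T | s * η ≤ (-s) * centredTime θ T R k} := by
    intro T hT
    have hT : η ≤ |centredTime θ T R k| := hT
    rcases le_abs.1 hT with h | h
    · exact Or.inl (mul_le_mul_of_nonneg_left h hs0.le)
    · refine Or.inr ?_
      have := mul_le_mul_of_nonneg_left h hs0.le
      show s * η ≤ -s * _
      linarith
  refine (measure_mono hsub).trans ((measure_union_le _ _).trans ?_)
  rw [two_mul]
  exact add_le_add (hside s hs rfl) (hside (-s) (by linarith) (by ring))

variable {θ}

theorem chain_congr (T : Ball d → ℝ) {R R' : ℕ → Selector (Ball d)} (k : ℕ)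
    (h : ∀ j ≤ k, R j = R' j) : chain θ T R k = chain θ T R' k := by
  induction k with
  | zero => simp [chain, h 0 le_rfl]
  | succ k ih => simp [chain, h (k + 1) le_rfl, ih fun j hj => h j (by omega)]

theorem centredTime_congr (T : Ball d → ℝ) {R R' : ℕ → Selector (Ball d)} (k : ℕ)
    (h : ∀ j ≤ k, R j = R' j) : centredTime θ T R k = centredTime θ T R' k := by
  rw [centredTime, centredTime, chain_congr T k h]
  congr 1
  refine Finset.sum_congr rfl fun j hj => ?_
  rw [chain_congr T j fun i hi => h i (hi.trans (Finset.mem_range.1 hj).le)]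

section Driver

variable {Ω : Type*} [MeasurableSpace Ω] {P : Measure Ω}
  {T : Ball d → Ω → ℝ} {R : ℕ → Ω → Selector (Ball d)}

theorem IsDriver.measurable_lifetimes (h : IsDriver P T R) : Measurable fun ω b => T b ω :=
  measurable_pi_iff.2 h.measurable_T

variable [IsProbabilityMeasure P]

theorem IsDriver.map_eq (h : IsDriver P T R) :
    P.map (fun ω b => T b ω) = lifeLaw (Ball d) := by
  rw [(iIndepFun_iff_map_fun_eq_pi_map fun b => (h.measurable_T b).aemeasurable).1 h.indep_T]
  simp only [h.law_T]
  rfl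

theorem IsDriver.measure_preimage (h : IsDriver P T R) {A : Set (Ball d → ℝ)}
    (hA : MeasurableSet A) : P {ω | (fun b => T b ω) ∈ A} = lifeLaw (Ball d) A := by
  rw [← h.map_eq, Measure.map_apply h.measurable_lifetimes hA]
  rfl

/-- An event that depends on the lifetimes and on finitely many choices of the balls that are
recoloured has at most the largest of its probabilities for given choices. -/
theorem IsDriver.measure_le (h : IsDriver P T R) (k : ℕ)
    (A : (ℕ → Selector (Ball d)) → Set (Ball d → ℝ)) (hA : ∀ r, MeasurableSet (A r))
    (hloc : ∀ r r', (∀ j ≤ k, r j = r' j) → A r = A r') {C : ENNReal}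
    (hC : ∀ r, lifeLaw (Ball d) (A r) ≤ C) :
    P {ω | (fun b => T b ω) ∈ A (fun j => R j ω)} ≤ C := by
  classical
  let ι := Fin (k + 1) → Selector (Ball d)
  have : Fintype ι := Fintype.ofFinite ι
  -- The event is determined by the choices `0, …, k`, which take finitely many values; `ext`
  -- prolongs them arbitrarily, by repeating the last. Summing over these values replaces
  -- conditioning on the choices.
  let ext : ι → ℕ → Selector (Ball d) := fun ρ j => ρ ⟨min j k, by omega⟩
  let res : (ℕ → Selector (Ball d)) → ι := fun r j => r j
  have hres : Measurable res := measurable_pi_iff.2 fun j => measurable_pi_apply _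
  have hR : Measurable fun ω j => R j ω := measurable_pi_iff.2 h.measurable_R
  have hsub : {ω | (fun b => T b ω) ∈ A (fun j => R j ω)} ⊆
      ⋃ ρ ∈ (Finset.univ : Finset ι),
        ((fun ω b => T b ω) ⁻¹' A (ext ρ)) ∩ ((fun ω j => R j ω) ⁻¹' (res ⁻¹' {ρ})) := by
    intro ω hω
    simp only [Set.mem_iUnion, Finset.mem_univ, exists_true_left]
    refine ⟨res fun j => R j ω, ?_, rfl⟩
    have : A (ext (res fun j => R j ω)) = A fun j => R j ω := by
      refine hloc _ _ fun j hj => ?_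
      simp [ext, res, hj]
    show _ ∈ A _
    rw [this]
    exact hω
  refine (measure_mono hsub).trans ((measure_biUnion_finset_le _ _).trans ?_)
  have hterm : ∀ ρ : ι, P (((fun ω b => T b ω) ⁻¹' A (ext ρ)) ∩
      ((fun ω j => R j ω) ⁻¹' (res ⁻¹' {ρ}))) ≤
      C * P ((fun ω => res fun j => R j ω) ⁻¹' {ρ}) := by
    intro ρ
    rw [h.indep_T_R.measure_inter_preimage_eq_mul _ _ (hA _) (hres (measurableSet_singleton ρ))]
    refine mul_le_mul' ?_ le_rfl
    have := h.measure_preimage (hA (ext ρ))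
    exact (le_of_eq this).trans (hC _)
  refine (Finset.sum_le_sum fun ρ _ => hterm ρ).trans ?_
  have hcomp : Measurable fun ω => res fun j => R j ω := hres.comp hR
  rw [← Finset.mul_sum, sum_measure_preimage_singleton _ fun ρ _ =>
    hcomp (measurableSet_singleton ρ)]
  simp

theorem IsDriver.measure_centredTime_le (h : IsDriver P T R) {s w η : ℝ} (hw : 0 < w)
    (hs0 : 0 < s) (hs : 2 * s ≤ w) (k : ℕ) (hM : w + 2 * k + 1 ≤ ∑ i, d i) :
    P {ω | η ≤ |centredTime θ (fun b => T b ω) (fun j => R j ω) k|} ≤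
      2 * ENNReal.ofReal (Real.exp (2 * k * (s / w) ^ 2 - s * η)) := by
  refine h.measure_le k (fun r => {T | η ≤ |centredTime θ T r k|}) (fun r => ?_)
    (fun r r' hr => ?_) fun r => lifeLaw_centredTime_le θ hw hs0 hs k r hM
  · exact measurableSet_le measurable_const (measurable_centredTime θ r k).abs
  · ext T
    simp only [Set.mem_ofPred_eq, centredTime_congr T k hr]

end Driver

end Waiting

/-! ### Mean and variance of the number of alive balls in bins of type `B`. -/

section AliveB

/-- The mean number of alive balls in a bin, on the event that the bin is of type `B`, when `z` is
the probability that a ball is alive. -/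
def meanAliveB (z : ℝ) (x : ℕ × ℕ) : ℝ :=
  if 1 ≤ x.2 then ∑ l ∈ Finset.Icc (x.1 - x.2) x.1, (l : ℝ) * binomProb x.1 z l else 0

theorem hB_eq (p : ℕ × ℕ → ℝ) (z : ℝ) : hB p z = ∑' x, meanAliveB z x * p x := by
  refine tsum_congr fun x => ?_
  rw [meanAliveB]
  split_ifs
  · rw [Finset.sum_mul]
    exact Finset.sum_congr rfl fun l _ => by ring
  · simp

theorem binomProb_nonneg {z : ℝ} (hz : z ∈ Set.Icc (0 : ℝ) 1) (m l : ℕ) : 0 ≤ binomProb m z l := by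
  have : 0 ≤ 1 - z := by linarith [hz.2]
  have := hz.1
  unfold binomProb
  positivity

theorem sum_binomProb (m : ℕ) (z : ℝ) : ∑ l ∈ Finset.range (m + 1), binomProb m z l = 1 := by
  have h := add_pow z (1 - z) m
  rw [show z + (1 - z) = 1 by ring, one_pow] at h
  rw [h]
  exact Finset.sum_congr rfl fun l _ => by unfold binomProb; ring

theorem meanAliveB_nonneg {z : ℝ} (hz : z ∈ Set.Icc (0 : ℝ) 1) (x : ℕ × ℕ) :
    0 ≤ meanAliveB z x := by
  rw [meanAliveB]
  split_ifs
  · exact Finset.sum_nonneg fun l _ => mul_nonneg l.cast_nonneg (binomProb_nonneg hz _ _)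
  · exact le_rfl

theorem meanAliveB_le {z : ℝ} (hz : z ∈ Set.Icc (0 : ℝ) 1) (x : ℕ × ℕ) :
    meanAliveB z x ≤ x.1 := by
  rw [meanAliveB]
  split_ifs
  · calc ∑ l ∈ Finset.Icc (x.1 - x.2) x.1, (l : ℝ) * binomProb x.1 z l
        ≤ ∑ l ∈ Finset.range (x.1 + 1), (x.1 : ℝ) * binomProb x.1 z l := by
          refine (Finset.sum_le_sum fun l hl => ?_).trans
            (Finset.sum_le_sum_of_subset_of_nonneg (fun l hl => ?_) fun l _ _ => ?_)
          · exact mul_le_mul_of_nonneg_right (by exact_mod_cast (Finset.mem_Icc.1 hl).2)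
              (binomProb_nonneg hz _ _)
          · rw [Finset.mem_Icc] at hl
            rw [Finset.mem_range]
            omega
          · exact mul_nonneg (Nat.cast_nonneg _) (binomProb_nonneg hz _ _)
      _ = x.1 := by rw [← Finset.mul_sum, sum_binomProb, mul_one]
  · exact Nat.cast_nonneg _

variable {n : ℕ} {d : Fin n → ℕ} (θ : Fin n → ℕ)

/-- The number of alive balls in bin `i` if it is of type `B`, and `0` otherwise. -/
def binAliveB (T : Ball d → ℝ) (t : ℝ) (i : Fin n) : ℝ :=
  if 1 ≤ θ i ∧ d i - θ i ≤ aliveIn T i t then (aliveIn T i t : ℝ) else 0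

theorem card_aliveB_eq (T : Ball d → ℝ) (t : ℝ) :
    ((aliveB θ T t).card : ℝ) = ∑ i, binAliveB θ T t i := by
  rw [Finset.card_eq_sum_card_fiberwise (f := fun b => b.1) (t := Finset.univ)
    fun _ _ => Finset.mem_coe.2 (Finset.mem_univ _)]
  push_cast
  refine Finset.sum_congr rfl fun i _ => ?_
  rw [binAliveB]
  split_ifs with h
  · congr 1
    rw [aliveIn]
    congr 1
    ext b
    simp only [aliveB, Finset.mem_filter, Finset.mem_univ, true_and]
    constructor
    · rintro ⟨⟨h1, -⟩, h2⟩; exact ⟨h2, h1⟩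
    · rintro ⟨h1, h2⟩
      subst h1
      exact ⟨⟨h2, by omega, h.2⟩, rfl⟩
  · rw [Nat.cast_eq_zero, Finset.card_eq_zero]
    ext b
    simp only [aliveB, Finset.mem_filter, Finset.mem_univ, true_and, Finset.notMem_empty, iff_false]
    rintro ⟨⟨-, h2, h3⟩, h4⟩
    subst h4
    exact h ⟨by omega, h3⟩

theorem aliveIn_eq (T : Ball d → ℝ) (i : Fin n) (t : ℝ) :
    aliveIn T i t = (Finset.univ.filter fun j : Fin (d i) => t < T ⟨i, j⟩).card := by
  symm
  refine Finset.card_bij (fun j _ => ⟨i, j⟩) ?_ ?_ ?_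
  · intro j hj
    simpa using hj
  · intro j _ j' _ h
    simpa using h
  · rintro ⟨i', j⟩ hb
    simp only [Finset.mem_filter, Finset.mem_univ, true_and] at hb
    obtain ⟨rfl, h2⟩ := hb
    exact ⟨j, by simpa using h2, rfl⟩

theorem aliveIn_le (T : Ball d → ℝ) (i : Fin n) (t : ℝ) : aliveIn T i t ≤ d i := by
  rw [aliveIn_eq]
  exact (Finset.card_filter_le _ _).trans (by simp)

theorem binAliveB_nonneg (T : Ball d → ℝ) (t : ℝ) (i : Fin n) : 0 ≤ binAliveB θ T t i := by
  rw [binAliveB]; split_ifs <;> positivity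

theorem binAliveB_le (T : Ball d → ℝ) (t : ℝ) (i : Fin n) : binAliveB θ T t i ≤ d i := by
  rw [binAliveB]; split_ifs
  · exact_mod_cast aliveIn_le T i t
  · exact Nat.cast_nonneg _

/-- `binAliveB` as a function of the set of alive balls in the bin. -/
theorem binAliveB_factor (t : ℝ) (i : Fin n) : ∃ g : (Fin (d i) → Bool) → ℝ,
    ∀ T : Ball d → ℝ, binAliveB θ T t i = g fun j => decide (t < T ⟨i, j⟩) := by
  refine ⟨fun q => if 1 ≤ θ i ∧ d i - θ i ≤ (Finset.univ.filter fun j => q j = true).card then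
    ((Finset.univ.filter fun j => q j = true).card : ℝ) else 0, fun T => ?_⟩
  simp only [binAliveB, aliveIn_eq, decide_eq_true_eq]

theorem measurable_decide_lt (t : ℝ) : Measurable fun x : ℝ => decide (t < x) := by
  refine measurable_to_bool ?_
  have : (fun x : ℝ => decide (t < x)) ⁻¹' {true} = Set.Ioi t := by ext x; simp
  rw [this]
  exact measurableSet_Ioi

theorem measurable_binAliveB (t : ℝ) (i : Fin n) :
    Measurable fun T : Ball d → ℝ => binAliveB θ T t i := by
  obtain ⟨g, hg⟩ := binAliveB_factor θ t i
  rw [funext hg]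
  exact (measurable_of_finite g).comp
    (measurable_pi_iff.2 fun j => (measurable_decide_lt t).comp (measurable_pi_apply _))

/-- Each variable depends only on the lifetimes in its own bin, and distinct bins have disjoint sets
of balls. -/
theorem indepFun_binAliveB (t : ℝ) {i i' : Fin n} (hii : i ≠ i') :
    IndepFun (fun T : Ball d → ℝ => binAliveB θ T t i) (fun T => binAliveB θ T t i')
      (lifeLaw (Ball d)) := by
  have hind : iIndepFun (fun (b : Ball d) (T : Ball d → ℝ) => T b) (lifeLaw (Ball d)) :=
    iIndepFun_pi (X := fun _ x => x) fun _ => measurable_id.aemeasurable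
  have hdisj : Disjoint (Finset.univ.filter fun b : Ball d => b.1 = i)
      (Finset.univ.filter fun b : Ball d => b.1 = i') := by
    rw [Finset.disjoint_filter]
    intro b _ h1 h2
    exact hii (h1.symm.trans h2)
  have h := hind.indepFun_finset _ _ hdisj fun b => measurable_pi_apply b
  have hcomp : ∀ i : Fin n, ∃ g : ((Finset.univ.filter fun b : Ball d => b.1 = i) → ℝ) → ℝ,
      Measurable g ∧ (fun T : Ball d → ℝ => binAliveB θ T t i) = g ∘ fun T b => T b := by
    intro i
    obtain ⟨g, hg⟩ := binAliveB_factor (d := d) θ t i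
    refine ⟨fun y => g fun j => decide (t < y ⟨⟨i, j⟩, by simp⟩), ?_, funext fun T => hg T⟩
    exact (measurable_of_finite g).comp
      (measurable_pi_iff.2 fun j => (measurable_decide_lt t).comp (measurable_pi_apply _))
  obtain ⟨g, hgm, hg⟩ := hcomp i
  obtain ⟨g', hgm', hg'⟩ := hcomp i'
  rw [hg, hg']
  exact h.comp hgm hgm'

theorem expMeasure_one_Ioi {t : ℝ} (ht : 0 ≤ t) :
    expMeasure 1 (Set.Ioi t) = ENNReal.ofReal (Real.exp (-t)) := by
  have h := congrArg (fun μ => μ Set.univ) (map_sub_restrict_expMeasure ht)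
  have hm : Measurable fun y : ℝ => y - t := measurable_id.sub_const t
  simpa [Measure.map_apply hm MeasurableSet.univ] using h

theorem expMeasure_one_Iic {t : ℝ} (ht : 0 ≤ t) :
    expMeasure 1 (Set.Iic t) = ENNReal.ofReal (1 - Real.exp (-t)) := by
  rw [← Set.compl_Ioi, prob_compl_eq_one_sub measurableSet_Ioi, expMeasure_one_Ioi ht,
    ← ENNReal.ofReal_one, ENNReal.ofReal_sub _ (Real.exp_pos _).le]

/-- The event that exactly the balls `S` of bin `i` are alive at time `t`. -/
def aliveEvent (t : ℝ) (i : Fin n) (S : Finset (Fin (d i))) : Set (Ball d → ℝ) :=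
  {T | (Finset.univ.filter fun j : Fin (d i) => t < T ⟨i, j⟩) = S}

theorem measurableSet_aliveEvent (t : ℝ) (i : Fin n) (S : Finset (Fin (d i))) :
    MeasurableSet (aliveEvent t i S) := by
  have hm : Measurable fun (T : Ball d → ℝ) (j : Fin (d i)) => decide (t < T ⟨i, j⟩) :=
    measurable_pi_iff.2 fun j => (measurable_decide_lt t).comp (measurable_pi_apply _)
  have : aliveEvent (d := d) t i S = (fun (T : Ball d → ℝ) (j : Fin (d i)) =>
      decide (t < T ⟨i, j⟩)) ⁻¹' {q | (Finset.univ.filter fun j => q j = true) = S} := by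
    ext T; simp [aliveEvent]
  rw [this]
  exact hm (Set.toFinite _).measurableSet

theorem lifeLaw_aliveEvent {t : ℝ} (ht : 0 ≤ t) (i : Fin n) (S : Finset (Fin (d i))) :
    (lifeLaw (Ball d)).real (aliveEvent t i S) =
      Real.exp (-t) ^ S.card * (1 - Real.exp (-t)) ^ (d i - S.card) := by
  classical
  have hz : 0 ≤ 1 - Real.exp (-t) := by
    have : Real.exp (-t) ≤ 1 := Real.exp_le_one_iff.2 (by linarith)
    linarith
  have hpi : aliveEvent (d := d) t i S = Set.univ.pi fun b : Ball d =>
      if h : b.1 = i then (if (h ▸ b.2) ∈ S then Set.Ioi t else Set.Iic t) else Set.univ := by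
    ext T
    simp only [aliveEvent, Set.mem_ofPred_eq, Set.mem_pi, Set.mem_univ, true_implies]
    constructor
    · rintro hS ⟨i', j⟩
      by_cases h : i' = i
      · subst h
        simp only [dif_pos]
        rw [← hS]
        by_cases hj : t < T ⟨i', j⟩
        · simp [hj]
        · simp [hj, not_lt.1 hj]
      · simp [h]
    · intro h
      ext j
      have hj := h ⟨i, j⟩
      simp only [dif_pos] at hj
      by_cases hjS : j ∈ S
      · simpa [hjS] using hj
      · simpa [hjS] using hj
  have hprod : lifeLaw (Ball d) (aliveEvent t i S) =
      ENNReal.ofReal (Real.exp (-t) ^ S.card * (1 - Real.exp (-t)) ^ (d i - S.card)) := by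
    rw [hpi, lifeLaw, Measure.pi_pi, Fintype.prod_sigma, Finset.prod_eq_single i]
    · simp only [dif_pos, apply_ite (expMeasure 1), expMeasure_one_Ioi ht, expMeasure_one_Iic ht]
      rw [Finset.prod_ite, Finset.prod_const, Finset.prod_const,
        ENNReal.ofReal_mul (by positivity), ENNReal.ofReal_pow (Real.exp_pos _).le,
        ENNReal.ofReal_pow hz]
      congr 2
      · simp
      · rw [Finset.filter_not, Finset.card_sdiff_of_subset (Finset.filter_subset _ _)]
        simp
    · intro i' _ hi'
      simp [hi']
    · simp
  rw [Measure.real, hprod, ENNReal.toReal_ofReal (by positivity)]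

/-- The mean is a sum over the possible sets of alive balls of the bin; grouping these sets by size
produces the binomial coefficients. -/
theorem integral_binAliveB {t : ℝ} (ht : 0 ≤ t) (i : Fin n) :
    ∫ T, binAliveB θ T t i ∂(lifeLaw (Ball d)) = meanAliveB (Real.exp (-t)) (d i, θ i) := by
  classical
  let g : ℕ → ℝ := fun l => if 1 ≤ θ i ∧ d i - θ i ≤ l then (l : ℝ) else 0
  have h1 : ∀ T : Ball d → ℝ, binAliveB θ T t i =
      ∑ S : Finset (Fin (d i)), (aliveEvent t i S).indicator (fun _ => g S.card) T := by
    intro T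
    rw [Finset.sum_eq_single (Finset.univ.filter fun j : Fin (d i) => t < T ⟨i, j⟩)]
    · have hmem : T ∈ aliveEvent t i (Finset.univ.filter fun j : Fin (d i) => t < T ⟨i, j⟩) := rfl
      rw [Set.indicator_of_mem hmem]
      simp only [binAliveB, aliveIn_eq, g]
    · intro S _ hS
      have hmem : T ∉ aliveEvent t i S := fun h => hS (Eq.symm h)
      exact Set.indicator_of_notMem hmem _
    · simp
  simp only [h1]
  rw [integral_finsetSum _ fun S _ =>
    (integrable_const _).indicator (measurableSet_aliveEvent t i S)]
  simp only [integral_indicator_const _ (measurableSet_aliveEvent t i _), smul_eq_mul,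
    lifeLaw_aliveEvent ht]
  rw [← Finset.powerset_univ, Finset.sum_powerset_apply_card
    (fun m => Real.exp (-t) ^ m * (1 - Real.exp (-t)) ^ (d i - m) * g m), Finset.card_fin,
    meanAliveB]
  split_ifs with hθ
  · symm
    refine Finset.sum_subset_zero_on_sdiff (fun l hl => ?_) (fun l hl => ?_) fun l hl => ?_
    · rw [Finset.mem_Icc] at hl
      rw [Finset.mem_range]
      omega
    · rw [Finset.mem_sdiff, Finset.mem_range, Finset.mem_Icc] at hl
      have : g l = 0 := if_neg fun h => hl.2 ⟨h.2, by omega⟩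
      rw [this, mul_zero, smul_zero]
    · rw [Finset.mem_Icc] at hl
      have : g l = l := if_pos ⟨hθ, hl.1⟩
      rw [this, nsmul_eq_mul, binomProb]
      ring
  · refine Finset.sum_eq_zero fun l _ => ?_
    have : g l = 0 := if_neg fun h => hθ h.1
    rw [this, mul_zero, smul_zero]

theorem memLp_binAliveB (t : ℝ) (i : Fin n) :
    MemLp (fun T : Ball d → ℝ => binAliveB θ T t i) 2 (lifeLaw (Ball d)) := by
  refine MemLp.of_bound (measurable_binAliveB θ t i).aestronglyMeasurable (d i)
    (Eventually.of_forall fun T => ?_)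
  rw [Real.norm_of_nonneg (binAliveB_nonneg θ T t i)]
  exact binAliveB_le θ T t i

theorem measurable_card_aliveB (t : ℝ) :
    Measurable fun T : Ball d → ℝ => ((aliveB θ T t).card : ℝ) := by
  simp only [card_aliveB_eq]
  exact Finset.measurable_sum _ fun i _ => measurable_binAliveB θ t i

/-- Chebyshev's inequality: the bins are independent, and the contribution of bin `i` lies in `[0, d
i]`, so its variance is at most `(d i)²`. -/
theorem lifeLaw_card_aliveB_le {t c : ℝ} (ht : 0 ≤ t) (hc : 0 < c) :
    lifeLaw (Ball d) {T | c ≤ |((aliveB θ T t).card : ℝ) -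
      ∑ i, meanAliveB (Real.exp (-t)) (d i, θ i)|} ≤
      ENNReal.ofReal ((∑ i, (d i : ℝ) ^ 2) / c ^ 2) := by
  let X : Fin n → (Ball d → ℝ) → ℝ := fun i T => binAliveB θ T t i
  have hX : ∀ i, MemLp (X i) 2 (lifeLaw (Ball d)) := fun i => memLp_binAliveB θ t i
  have hsum : MemLp (∑ i, X i) 2 (lifeLaw (Ball d)) := memLp_finsetSum' _ fun i _ => hX i
  have hmean : ∫ T, (∑ i, X i) T ∂(lifeLaw (Ball d)) =
      ∑ i, meanAliveB (Real.exp (-t)) (d i, θ i) := by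
    simp only [Finset.sum_apply]
    rw [integral_finsetSum _ fun i _ => (hX i).integrable (by norm_num)]
    exact Finset.sum_congr rfl fun i _ => integral_binAliveB θ ht i
  have hvar : variance (∑ i, X i) (lifeLaw (Ball d)) ≤ ∑ i, (d i : ℝ) ^ 2 := by
    rw [IndepFun.variance_sum (fun i _ => hX i)
      fun i _ i' _ hii => indepFun_binAliveB θ t hii]
    refine Finset.sum_le_sum fun i _ => ?_
    refine (variance_le_sq_of_bounded (a := 0) (b := d i) (Eventually.of_forall fun T =>
      ⟨binAliveB_nonneg θ T t i, binAliveB_le θ T t i⟩)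
      (measurable_binAliveB θ t i).aemeasurable).trans ?_
    have : (0 : ℝ) ≤ d i := Nat.cast_nonneg _
    nlinarith
  have hcheb := meas_ge_le_variance_div_sq hsum hc
  rw [hmean] at hcheb
  refine le_trans (le_of_eq ?_) (hcheb.trans (ENNReal.ofReal_le_ofReal (by gcongr)))
  simp only [card_aliveB_eq, Finset.sum_apply, X]

end AliveB

/-! ### Consequences of the regularity condition: averages, continuity and the sign of the drift. -/

section Regularity

theorem sum_mul_numNodes {n : ℕ} (d θ : Fin n → ℕ) (f : ℕ × ℕ → ℝ) (F : Finset (ℕ × ℕ)) :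
    ∑ x ∈ F, f x * (numNodes d θ x.1 x.2 : ℝ) =
      ∑ i, if (d i, θ i) ∈ F then f (d i, θ i) else 0 := by
  have h : ∀ x : ℕ × ℕ, f x * (numNodes d θ x.1 x.2 : ℝ) =
      ∑ i, if (d i, θ i) = x then f x else 0 := by
    intro x
    rw [numNodes, Finset.card_filter]
    push_cast
    rw [Finset.mul_sum]
    refine Finset.sum_congr rfl fun i _ => ?_
    simp only [Prod.ext_iff]
    split_ifs <;> simp
  simp only [h]
  rw [Finset.sum_comm]
  refine Finset.sum_congr rfl fun i _ => ?_
  rw [Finset.sum_ite_eq]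

variable {d θ : (n : ℕ) → Fin n → ℕ} {p : ℕ × ℕ → ℝ}

/-- Since `d ≤ 2 ^ d`, the moment condition with `A = 4` dominates the second moment. -/
theorem Regular.exists_sum_sq_le (h : Regular d θ p) :
    ∃ C : ℝ, 0 < C ∧ ∀ᶠ n : ℕ in atTop, ∑ i, (d n i : ℝ) ^ 2 ≤ C * n := by
  obtain ⟨C, hC, hb⟩ := (h.moments 4 (by norm_num)).exists_pos
  refine ⟨C, hC, ?_⟩
  filter_upwards [hb.bound] with n hn
  rw [Real.norm_of_nonneg (Finset.sum_nonneg fun i _ => by positivity),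
    Real.norm_of_nonneg (Nat.cast_nonneg n)] at hn
  refine (Finset.sum_le_sum fun i _ => ?_).trans hn
  have h1 : (d n i : ℝ) ≤ 2 ^ d n i := by exact_mod_cast (Nat.lt_two_pow_self).le
  calc (d n i : ℝ) ^ 2 ≤ (2 ^ d n i) ^ 2 := by gcongr
    _ = 4 ^ d n i := by rw [← pow_mul, mul_comm, pow_mul]; norm_num

theorem Regular.summable_mul (h : Regular d θ p) : Summable fun x : ℕ × ℕ => (x.1 : ℝ) * p x := by
  obtain ⟨C, hC, hb⟩ := h.exists_sum_sq_le
  refine summable_of_sum_le (c := C) (fun x => mul_nonneg (Nat.cast_nonneg _) (h.p_nonneg x))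
    fun F => ?_
  have hlim : Tendsto (fun n : ℕ => ∑ x ∈ F, (x.1 : ℝ) *
      ((numNodes (d n) (θ n) x.1 x.2 : ℝ) / n)) atTop (𝓝 (∑ x ∈ F, (x.1 : ℝ) * p x)) :=
    tendsto_finsetSum _ fun x _ => (h.tendsto_freq x.1 x.2).const_mul _
  refine le_of_tendsto hlim ?_
  filter_upwards [hb, eventually_gt_atTop 0] with n hn hn0
  have hn0' : (0 : ℝ) < n := by exact_mod_cast hn0
  simp only [← mul_div_assoc]
  rw [← Finset.sum_div, div_le_iff₀ hn0', sum_mul_numNodes _ _ fun x => (x.1 : ℝ)]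
  refine (Finset.sum_le_sum fun i _ => ?_).trans hn
  have h2 : (d n i : ℝ) ≤ (d n i : ℝ) ^ 2 := by
    exact_mod_cast Nat.le_self_pow (by norm_num) (d n i)
  split_ifs
  · exact h2
  · positivity

theorem Regular.summable_of_le (h : Regular d θ p) {f : ℕ × ℕ → ℝ} (hf : ∀ x, |f x| ≤ x.1) :
    Summable fun x => f x * p x := by
  refine Summable.of_norm_bounded h.summable_mul fun x => ?_
  rw [norm_mul, Real.norm_of_nonneg (h.p_nonneg x)]
  exact mul_le_mul_of_nonneg_right (hf x) (h.p_nonneg x)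

/-- The averages of a function of degree and threshold of at most linear growth in the degree
converge to its mean in the limiting distribution. -/
theorem Regular.tendsto_average (h : Regular d θ p) {f : ℕ × ℕ → ℝ} (hf : ∀ x, |f x| ≤ x.1) :
    Tendsto (fun n : ℕ => (∑ i, f (d n i, θ n i)) / n) atTop (𝓝 (∑' x, f x * p x)) := by
  obtain ⟨C, hC, hb⟩ := h.exists_sum_sq_le
  rw [Metric.tendsto_nhds]
  intro ε hε
  -- Outside a finite set `F` carrying almost all the mass of `p`, the bound `d ≤ D + d² / D` is
  -- used. The choice of `D` makes the second term contribute at most `ε / 8` to the average, and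
  -- that of `F` does the same for the first.
  set D : ℝ := 8 * C / ε + 1 with hD
  have hDpos : 0 < D := by positivity
  have hCD : C / D < ε / 8 := by
    rw [div_lt_iff₀ hDpos, hD]
    have : ε / 8 * (8 * C / ε + 1) = C + ε / 8 := by field_simp
    linarith
  have hF1 : ∀ᶠ F : Finset (ℕ × ℕ) in atTop, 1 - ε / (8 * D) < ∑ x ∈ F, p x :=
    h.p_sum.eventually (lt_mem_nhds (sub_lt_self _ (by positivity)))
  have hF2 : ∀ᶠ F : Finset (ℕ × ℕ) in atTop,
      dist (∑ x ∈ F, f x * p x) (∑' x, f x * p x) < ε / 4 :=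
    Metric.tendsto_nhds.1 (h.summable_of_le hf).hasSum (ε / 4) (by positivity)
  obtain ⟨F, hF1, hF2⟩ := (hF1.and hF2).exists
  have hlim1 : Tendsto (fun n : ℕ => ∑ x ∈ F, f x *
      ((numNodes (d n) (θ n) x.1 x.2 : ℝ) / n)) atTop (𝓝 (∑ x ∈ F, f x * p x)) :=
    tendsto_finsetSum _ fun x _ => (h.tendsto_freq x.1 x.2).const_mul _
  have hlim2 : Tendsto (fun n : ℕ => ∑ x ∈ F, 1 *
      ((numNodes (d n) (θ n) x.1 x.2 : ℝ) / n)) atTop (𝓝 (∑ x ∈ F, 1 * p x)) :=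
    tendsto_finsetSum _ fun x _ => (h.tendsto_freq x.1 x.2).const_mul _
  simp only [one_mul] at hlim2
  filter_upwards [hb, eventually_gt_atTop 0, Metric.tendsto_nhds.1 hlim1 (ε / 4) (by positivity),
    hlim2.eventually (lt_mem_nhds hF1)] with n hn hn0 h1 h2
  have hn0' : (0 : ℝ) < n := by exact_mod_cast hn0
  have e1 : ∑ x ∈ F, f x * ((numNodes (d n) (θ n) x.1 x.2 : ℝ) / n) =
      (∑ i, if (d n i, θ n i) ∈ F then f (d n i, θ n i) else 0) / n := by
    rw [← sum_mul_numNodes, Finset.sum_div]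
    exact Finset.sum_congr rfl fun x _ => by ring
  have e2 : ∑ x ∈ F, ((numNodes (d n) (θ n) x.1 x.2 : ℝ) / n) =
      (∑ i, if (d n i, θ n i) ∈ F then (1 : ℝ) else 0) / n := by
    rw [← sum_mul_numNodes _ _ fun _ => (1 : ℝ), Finset.sum_div]
    exact Finset.sum_congr rfl fun x _ => by ring
  rw [e1] at h1
  rw [e2, lt_div_iff₀ hn0'] at h2
  have hdiff : |(∑ i, f (d n i, θ n i)) -
      ∑ i, (if (d n i, θ n i) ∈ F then f (d n i, θ n i) else 0)| ≤
      D * (n - ∑ i, if (d n i, θ n i) ∈ F then (1 : ℝ) else 0) + (∑ i, (d n i : ℝ) ^ 2) / D := by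
    have hn1 : (n : ℝ) = ∑ _i : Fin n, (1 : ℝ) := by simp
    rw [← Finset.sum_sub_distrib]
    conv_rhs => rw [hn1, ← Finset.sum_sub_distrib, Finset.mul_sum, Finset.sum_div,
      ← Finset.sum_add_distrib]
    refine (Finset.abs_sum_le_sum_abs _ _).trans (Finset.sum_le_sum fun i _ => ?_)
    split_ifs
    · simp; positivity
    · rw [sub_zero, sub_zero, mul_one]
      refine (hf _).trans ?_
      simp only
      rcases le_total (d n i : ℝ) D with hle | hle
      · have : 0 ≤ (d n i : ℝ) ^ 2 / D := by positivity
        linarith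
      · have : (d n i : ℝ) ≤ (d n i : ℝ) ^ 2 / D := by
          rw [le_div_iff₀ hDpos, sq]
          exact mul_le_mul_of_nonneg_left hle (Nat.cast_nonneg _)
        linarith
  have hbound : dist ((∑ i, f (d n i, θ n i)) / (n : ℝ))
      ((∑ i, if (d n i, θ n i) ∈ F then f (d n i, θ n i) else 0) / n) ≤ ε / 4 := by
    rw [Real.dist_eq, ← sub_div, abs_div, abs_of_pos hn0', div_le_iff₀ hn0']
    refine hdiff.trans ?_
    have h3 : D * (n - ∑ i, if (d n i, θ n i) ∈ F then (1 : ℝ) else 0) ≤ ε / 8 * n := by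
      have h4 : (n : ℝ) - (∑ i, if (d n i, θ n i) ∈ F then (1 : ℝ) else 0) ≤
          ε / (8 * D) * n := by linarith
      calc _ ≤ D * (ε / (8 * D) * n) := mul_le_mul_of_nonneg_left h4 hDpos.le
        _ = ε / 8 * n := by field_simp
    have h5 : (∑ i, (d n i : ℝ) ^ 2) / D ≤ ε / 8 * n := by
      calc (∑ i, (d n i : ℝ) ^ 2) / D ≤ C * n / D := by gcongr
        _ = C / D * n := by ring
        _ ≤ ε / 8 * n := by gcongr
    linarith
  refine (dist_triangle4 _ ((∑ i, if (d n i, θ n i) ∈ F then f (d n i, θ n i) else 0) / (n : ℝ))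
    (∑ x ∈ F, f x * p x) _).trans_lt ?_
  linarith

theorem Regular.meanDegree_pos (h : Regular d θ p) : 0 < meanDegree p := by
  have hnn : ∀ x : ℕ × ℕ, 0 ≤ (x.1 : ℝ) * p x := fun x =>
    mul_nonneg (Nat.cast_nonneg _) (h.p_nonneg x)
  refine lt_of_le_of_ne (tsum_nonneg hnn) fun h0 => ?_
  have h1 : ∀ x : ℕ × ℕ, (x.1 : ℝ) * p x = 0 := by
    have h2 := (hasSum_zero_iff_of_nonneg hnn).1 (by
      rw [h0]; exact h.summable_mul.hasSum)
    exact fun x => congrFun h2 x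
  have hinj : Function.Injective (Prod.mk (0 : ℕ) : ℕ → ℕ × ℕ) := Prod.mk_right_injective 0
  have h3 : HasSum (p ∘ Prod.mk 0) 1 := by
    refine (hinj.hasSum_iff fun x hx => ?_).2 h.p_sum
    have hx1 : x.1 ≠ 0 := fun h0 => hx ⟨x.2, by rw [← h0]⟩
    have := h1 x
    simpa [hx1] using this
  have h4 := h.degree_zero
  have h5 : ∑' b : ℕ, p (0, b) = 1 := h3.tsum_eq
  linarith

theorem continuous_meanAliveB (x : ℕ × ℕ) : Continuous fun z => meanAliveB z x := by
  unfold meanAliveB binomProb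
  split_ifs <;> fun_prop

theorem abs_meanAliveB_le {z : ℝ} (hz : z ∈ Set.Icc (0 : ℝ) 1) (x : ℕ × ℕ) :
    |meanAliveB z x| ≤ x.1 := by
  rw [abs_of_nonneg (meanAliveB_nonneg hz x)]
  exact meanAliveB_le hz x

theorem Regular.continuousOn_hB (h : Regular d θ p) : ContinuousOn (hB p) (Set.Icc 0 1) := by
  have heq : hB p = fun z => ∑' x, meanAliveB z x * p x := funext fun z => hB_eq p z
  rw [heq]
  refine continuousOn_tsum (fun x => ((continuous_meanAliveB x).mul_const _).continuousOn)
    h.summable_mul fun x z hz => ?_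
  rw [norm_mul, Real.norm_of_nonneg (h.p_nonneg x)]
  exact mul_le_mul_of_nonneg_right (abs_meanAliveB_le hz x) (h.p_nonneg x)

theorem Regular.continuousOn_driftFn (h : Regular d θ p) :
    ContinuousOn (driftFn p) (Set.Icc 0 1) :=
  ContinuousOn.sub (by fun_prop) h.continuousOn_hB

theorem Regular.driftFn_one_nonneg (h : Regular d θ p) : 0 ≤ driftFn p 1 := by
  have h1 : (1 : ℝ) ∈ Set.Icc (0 : ℝ) 1 := by simp
  rw [driftFn, hB_eq, meanDegree, one_pow, mul_one, sub_nonneg]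
  exact Summable.tsum_le_tsum (fun x => mul_le_mul_of_nonneg_right (meanAliveB_le h1 x)
    (h.p_nonneg x)) (h.summable_of_le (abs_meanAliveB_le h1)) h.summable_mul

theorem driftFn_zero (p : ℕ × ℕ → ℝ) : driftFn p 0 = 0 := by
  have h : ∀ x, meanAliveB 0 x = 0 := by
    intro x
    rw [meanAliveB]
    split_ifs
    · refine Finset.sum_eq_zero fun l _ => ?_
      rcases Nat.eq_zero_or_pos l with rfl | hl
      · simp
      · simp [binomProb, hl.ne']
    · rfl
  rw [driftFn, hB_eq]
  simp [h]

theorem Regular.zHat_mem (h : Regular d θ p) :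
    zHat p ∈ Set.Icc (0 : ℝ) 1 ∧ driftFn p (zHat p) = 0 := by
  have hclosed : IsClosed {z : ℝ | z ∈ Set.Icc (0 : ℝ) 1 ∧ driftFn p z = 0} :=
    h.continuousOn_driftFn.preimage_isClosed_of_isClosed isClosed_Icc isClosed_singleton
  have hcomp : IsCompact {z : ℝ | z ∈ Set.Icc (0 : ℝ) 1 ∧ driftFn p z = 0} :=
    isCompact_Icc.of_isClosed_subset hclosed fun z hz => hz.1
  exact hcomp.sSup_mem ⟨0, by simp, driftFn_zero p⟩

/-- The drift is nonnegative at `1`; a nonpositive value beyond `zHat p` would give, by the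
intermediate value theorem, a root larger than the largest one. -/
theorem Regular.driftFn_pos (h : Regular d θ p) {z : ℝ} (hz : zHat p < z) (hz1 : z ≤ 1) :
    0 < driftFn p z := by
  by_contra! hcon
  have hz0 : 0 ≤ z := h.zHat_mem.1.1.trans hz.le
  obtain ⟨y, hy, hy0⟩ := intermediate_value_Icc hz1
    (h.continuousOn_driftFn.mono (Set.Icc_subset_Icc_left hz0)) ⟨hcon, h.driftFn_one_nonneg⟩
  have hle : y ≤ zHat p :=
    le_csSup ⟨1, fun _ hx => hx.1.2⟩ ⟨⟨hz0.trans hy.1, hy.2⟩, hy0⟩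
  linarith [hy.1]

/-- The drift vanishes at `zHat p` and is positive to its right, so failure of local minimality must
come from negative values to its left, arbitrarily close. -/
theorem Regular.exists_driftFn_neg (h : Regular d θ p)
    (hmin : ¬ IsLocalMinOn (driftFn p) (Set.Icc (0 : ℝ) 1) (zHat p)) {y : ℝ} (hy : y < zHat p) :
    ∃ z, y < z ∧ z < zHat p ∧ 0 ≤ z ∧ driftFn p z < 0 := by
  by_contra! hcon
  refine hmin ?_
  have hev : ∀ᶠ z in 𝓝[Set.Icc (0 : ℝ) 1] (zHat p), y < z :=
    mem_nhdsWithin_of_mem_nhds (Ioi_mem_nhds hy)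
  filter_upwards [hev, self_mem_nhdsWithin] with z hz hz01
  rw [h.zHat_mem.2]
  rcases lt_trichotomy z (zHat p) with h1 | h1 | h1
  · exact hcon z hz h1 hz01.1
  · rw [h1, h.zHat_mem.2]
  · exact (h.driftFn_pos h1 hz01.2).le

end Regularity

/-! ### Logarithmic asymptotics of the mean death times. -/

section MeanTime

/-- Telescoping with `1 / y ≥ (log (y + 2) - log y) / 2`; the reverse bound below uses `1 / y ≤ (log
y - log (y - 2)) / 2`. -/
theorem le_meanTime {M k : ℕ} (hk : 2 * k ≤ M) :
    (Real.log (M + 1) - Real.log (M + 1 - 2 * k)) / 2 ≤ meanTime M k := by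
  induction k with
  | zero => simp [meanTime]
  | succ k ih =>
    have h := ih (by omega)
    rw [meanTime, Finset.sum_range_succ]
    rw [meanTime] at h
    have hy : (0 : ℝ) < M - 1 - 2 * k := by
      have : (2 * k + 2 : ℝ) ≤ M := by exact_mod_cast (by omega : 2 * k + 2 ≤ M)
      linarith
    set y : ℝ := M - 1 - 2 * k with hyd
    have e1 : (M : ℝ) + 1 - 2 * k = y + 2 := by rw [hyd]; ring
    have e2 : (M : ℝ) + 1 - 2 * ((k + 1 : ℕ) : ℝ) = y := by rw [hyd]; push_cast; ring
    rw [e1] at h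
    rw [e2]
    have h2 := Real.log_le_sub_one_of_pos (x := (y + 2) / y) (by positivity)
    rw [Real.log_div (by positivity) hy.ne'] at h2
    have h3 : (y + 2) / y - 1 = 2 * (1 / y) := by field_simp; ring
    linarith

theorem meanTime_le {M k : ℕ} (hk : 2 * k + 1 < M) :
    meanTime M k ≤ (Real.log (M - 1) - Real.log (M - 1 - 2 * k)) / 2 := by
  induction k with
  | zero => simp [meanTime]
  | succ k ih =>
    have h := ih (by omega)
    rw [meanTime, Finset.sum_range_succ]
    rw [meanTime] at h
    have hy : (2 : ℝ) < M - 1 - 2 * k := by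
      have : (2 * k + 4 : ℝ) ≤ M := by exact_mod_cast (by omega : 2 * k + 4 ≤ M)
      linarith
    set y : ℝ := M - 1 - 2 * k with hyd
    have e2 : (M : ℝ) - 1 - 2 * ((k + 1 : ℕ) : ℝ) = y - 2 := by rw [hyd]; push_cast; ring
    rw [e2]
    have hy0 : 0 < y := by linarith
    have hy2 : 0 < y - 2 := by linarith
    have h2 := Real.log_le_sub_one_of_pos (x := (y - 2) / y) (by positivity)
    rw [Real.log_div hy2.ne' hy0.ne'] at h2
    have h3 : (y - 2) / y - 1 = -(2 * (1 / y)) := by field_simp; ring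
    linarith

/-- The number of deaths up to time about `a`, if there are `M` balls. -/
def deathsBy (a : ℝ) (M : ℕ) : ℕ := ⌊((M : ℝ) - 1) * (1 - Real.exp (-(2 * a))) / 2⌋₊

/-- After `deathsBy a M` deaths a running process has `M - 1 - 2k` white balls, which exceeds `(M -
1) e^{-2a}` by at most `2`, the rounding error. -/
theorem deathsBy_bounds {a : ℝ} (ha : 0 < a) {M : ℕ} (hM : 2 ≤ M) :
    ((M : ℝ) - 1) * Real.exp (-(2 * a)) + 2 * deathsBy a M + 1 ≤ M ∧
      (M : ℝ) ≤ ((M : ℝ) - 1) * Real.exp (-(2 * a)) + 2 * deathsBy a M + 3 ∧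
      2 * deathsBy a M + 1 < M := by
  have hM' : (2 : ℝ) ≤ M := by exact_mod_cast hM
  have he : Real.exp (-(2 * a)) ≤ 1 := Real.exp_le_one_iff.2 (by linarith)
  have h1 : (deathsBy a M : ℝ) ≤ ((M : ℝ) - 1) * (1 - Real.exp (-(2 * a))) / 2 :=
    Nat.floor_le (div_nonneg (mul_nonneg (by linarith) (by linarith)) (by norm_num))
  have h2 : ((M : ℝ) - 1) * (1 - Real.exp (-(2 * a))) / 2 < deathsBy a M + 1 :=
    Nat.lt_floor_add_one _
  refine ⟨by linarith, by linarith, ?_⟩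
  have h3 : 0 < ((M : ℝ) - 1) * Real.exp (-(2 * a)) := mul_pos (by linarith) (Real.exp_pos _)
  have h4 : ((2 * deathsBy a M + 1 : ℕ) : ℝ) < M := by push_cast; linarith
  exact_mod_cast h4

theorem meanTime_deathsBy_le {a : ℝ} (ha : 0 < a) {M : ℕ} (hM : 2 ≤ M) :
    meanTime M (deathsBy a M) ≤ a := by
  obtain ⟨h1, -, h3⟩ := deathsBy_bounds ha hM
  have hM' : (2 : ℝ) ≤ M := by exact_mod_cast hM
  refine (meanTime_le h3).trans ?_
  have h4 : Real.log (((M : ℝ) - 1) * Real.exp (-(2 * a))) ≤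
      Real.log ((M : ℝ) - 1 - 2 * deathsBy a M) :=
    Real.log_le_log (mul_pos (by linarith) (Real.exp_pos _)) (by linarith)
  rw [Real.log_mul (by linarith) (Real.exp_pos _).ne', Real.log_exp] at h4
  linarith

theorem eventually_le_meanTime_deathsBy {a η : ℝ} (ha : 0 < a) (hη : 0 < η) :
    ∀ᶠ M : ℕ in atTop, a - η ≤ meanTime M (deathsBy a M) := by
  have hpos : 0 < Real.exp (-(2 * (a - η))) - Real.exp (-(2 * a)) :=
    sub_pos.2 (Real.exp_lt_exp.2 (by linarith))
  have hlim : Tendsto (fun M : ℕ => (M : ℝ) *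
      (Real.exp (-(2 * (a - η))) - Real.exp (-(2 * a)))) atTop atTop :=
    tendsto_natCast_atTop_atTop.atTop_mul_const hpos
  -- The slack `4` absorbs the rounding error and the shift from `M - 1` to `M + 1`.
  filter_upwards [eventually_ge_atTop 2, hlim.eventually_ge_atTop 4] with M hM h4
  obtain ⟨h1, h2, h3⟩ := deathsBy_bounds ha hM
  have hM' : (2 : ℝ) ≤ M := by exact_mod_cast hM
  refine le_trans ?_ (le_meanTime (by omega))
  have h5 : (0 : ℝ) < M + 1 - 2 * deathsBy a M := by
    have : ((2 * deathsBy a M + 1 : ℕ) : ℝ) < M := by exact_mod_cast h3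
    push_cast at this
    linarith
  have he := Real.exp_pos (-(2 * a))
  have he' := Real.exp_pos (-(2 * (a - η)))
  have h6 : Real.log ((M : ℝ) + 1 - 2 * deathsBy a M) ≤
      Real.log (((M : ℝ) + 1) * Real.exp (-(2 * (a - η)))) :=
    Real.log_le_log h5 (by nlinarith)
  rw [Real.log_mul (by linarith) he'.ne', Real.log_exp] at h6
  linarith

end MeanTime

/-! ### The two probabilistic bounds for the stopping time. -/

section Limit

variable {d θ : (n : ℕ) → Fin n → ℕ} {p : ℕ × ℕ → ℝ}

theorem Regular.tendsto_sum_degree_div (h : Regular d θ p) :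
    Tendsto (fun n : ℕ => ((∑ i, d n i : ℕ) : ℝ) / n) atTop (𝓝 (meanDegree p)) := by
  have := h.tendsto_average (f := fun x => (x.1 : ℝ)) fun x => by simp
  simpa [meanDegree] using this

theorem Regular.tendsto_sum_degree (h : Regular d θ p) :
    Tendsto (fun n : ℕ => ∑ i, d n i) atTop atTop := by
  have h1 : Tendsto (fun n : ℕ => ((∑ i, d n i : ℕ) : ℝ) / n * n) atTop atTop :=
    h.tendsto_sum_degree_div.pos_mul_atTop h.meanDegree_pos tendsto_natCast_atTop_atTop
  refine tendsto_natCast_atTop_iff.1 (h1.congr' ?_)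
  filter_upwards [eventually_gt_atTop 0] with n hn
  have : (n : ℝ) ≠ 0 := by positivity
  field_simp

variable {Ω : ℕ → Type*} [∀ n, MeasurableSpace (Ω n)] {P : (n : ℕ) → Measure (Ω n)}
  [∀ n, IsProbabilityMeasure (P n)] {T : (n : ℕ) → Ball (d n) → Ω n → ℝ}
  {R : (n : ℕ) → ℕ → Ω n → Selector (Ball (d n))}

theorem Regular.tendsto_centredTime (h : Regular d θ p) (hTR : ∀ n, IsDriver (P n) (T n) (R n))
    {a η : ℝ} (ha : 0 < a) (hη : 0 < η) :
    Tendsto (fun n => P n {ω | η ≤ |centredTime (θ n) (fun b => T n b ω) (fun k => R n k ω)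
      (deathsBy a (∑ i, d n i))|}) atTop (𝓝 0) := by
  rw [ENNReal.tendsto_nhds_zero]
  intro ε hε
  have hlim : Tendsto (fun s : ℝ => 2 * ENNReal.ofReal (Real.exp (1 - s * η))) atTop (𝓝 0) := by
    have h1 : Tendsto (fun s : ℝ => Real.exp (1 - s * η)) atTop (𝓝 0) := by
      refine Real.tendsto_exp_atBot.comp ?_
      simp only [sub_eq_add_neg]
      exact tendsto_atBot_add_const_left _ _
        (tendsto_neg_atTop_atBot.comp (tendsto_id.atTop_mul_const hη))
    have h2 := ENNReal.Tendsto.const_mul (a := 2) (ENNReal.tendsto_ofReal h1)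
      (Or.inr (by norm_num))
    simpa using h2
  -- First `s` is fixed so large that `2 exp (1 - s η) ≤ ε`. With `w = (M - 1) e^{-2a}` and `2k ≤
  -- M`, the quadratic term `2k (s / w)²` is of order `1 / M`, hence at most `1` for large `n`.
  obtain ⟨s, hs, hs0⟩ :=
    ((hlim.eventually (ge_mem_nhds hε)).and (eventually_gt_atTop (0 : ℝ))).exists
  have he := Real.exp_pos (-(2 * a))
  have hM := h.tendsto_sum_degree
  have hMr : Tendsto (fun n : ℕ => ((∑ i, d n i : ℕ) : ℝ)) atTop atTop :=
    tendsto_natCast_atTop_atTop.comp hM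
  filter_upwards [hM.eventually_ge_atTop 2,
    (hMr.atTop_mul_const he).eventually_ge_atTop (4 * s),
    (hMr.atTop_mul_const (pow_pos he 2)).eventually_ge_atTop (4 * s ^ 2)] with n h2 h3 h4
  refine le_trans ?_ hs
  set M : ℕ := ∑ i, d n i with hMdef
  obtain ⟨b1, b2, b3⟩ := deathsBy_bounds ha h2
  have h2' : (2 : ℝ) ≤ M := by exact_mod_cast h2
  have hw : 0 < ((M : ℝ) - 1) * Real.exp (-(2 * a)) := mul_pos (by linarith) he
  have hhalf : (M : ℝ) / 2 * Real.exp (-(2 * a)) ≤ ((M : ℝ) - 1) * Real.exp (-(2 * a)) :=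
    mul_le_mul_of_nonneg_right (by linarith) he.le
  refine ((hTR n).measure_centredTime_le (θ := θ n) (η := η) hw hs0 (by linarith)
    (deathsBy a M) (by rw [← hMdef]; exact b1)).trans ?_
  gcongr
  rw [div_pow, ← mul_div_assoc, div_le_one (pow_pos hw 2)]
  have hk : (2 * deathsBy a M : ℝ) ≤ M := by
    have : ((2 * deathsBy a M + 1 : ℕ) : ℝ) < M := by exact_mod_cast b3
    push_cast at this
    linarith
  calc 2 * (deathsBy a M : ℝ) * s ^ 2 ≤ M * s ^ 2 := by gcongr
    _ ≤ M * (M * Real.exp (-(2 * a)) ^ 2 / 4) := by gcongr; linarith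
    _ = (M / 2 * Real.exp (-(2 * a))) ^ 2 := by ring
    _ ≤ (((M : ℝ) - 1) * Real.exp (-(2 * a))) ^ 2 := by gcongr

theorem exp_neg_mem {t : ℝ} (ht : 0 ≤ t) : Real.exp (-t) ∈ Set.Icc (0 : ℝ) 1 :=
  ⟨(Real.exp_pos _).le, Real.exp_le_one_iff.2 (by linarith)⟩

theorem Regular.tendsto_card_aliveB (h : Regular d θ p) (hTR : ∀ n, IsDriver (P n) (T n) (R n))
    {t δ : ℝ} (ht : 0 ≤ t) (hδ : 0 < δ) :
    Tendsto (fun n => P n {ω | δ * n ≤ |((aliveB (θ n) (fun b => T n b ω) t).card : ℝ) -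
      n * hB p (Real.exp (-t))|}) atTop (𝓝 0) := by
  obtain ⟨C, hC, hCn⟩ := h.exists_sum_sq_le
  have hmean := h.tendsto_average (f := meanAliveB (Real.exp (-t)))
    (abs_meanAliveB_le (exp_neg_mem ht))
  rw [← hB_eq] at hmean
  have hlim : Tendsto (fun n : ℕ => ENNReal.ofReal (4 * C / δ ^ 2 / n)) atTop (𝓝 0) := by
    have := ENNReal.tendsto_ofReal (tendsto_const_div_atTop_nhds_zero_nat (4 * C / δ ^ 2))
    simpa using this
  refine tendsto_of_tendsto_of_tendsto_of_le_of_le' tendsto_const_nhds hlim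
    (Eventually.of_forall fun _ => zero_le) ?_
  filter_upwards [hCn, eventually_gt_atTop 0,
    Metric.tendsto_nhds.1 hmean (δ / 2) (by positivity)] with n hn hn0 hd
  have hn0' : (0 : ℝ) < n := by exact_mod_cast hn0
  have hc : 0 < δ / 2 * n := by positivity
  have hbound : |(∑ i, meanAliveB (Real.exp (-t)) (d n i, θ n i)) - n * hB p (Real.exp (-t))| ≤
      δ / 2 * n := by
    rw [Real.dist_eq] at hd
    have h1 : (∑ i, meanAliveB (Real.exp (-t)) (d n i, θ n i)) - n * hB p (Real.exp (-t)) =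
        ((∑ i, meanAliveB (Real.exp (-t)) (d n i, θ n i)) / n - hB p (Real.exp (-t))) * n := by
      field_simp
    rw [h1, abs_mul, abs_of_pos hn0']
    exact mul_le_mul_of_nonneg_right hd.le hn0'.le
  have hmeas : MeasurableSet {S : Ball (d n) → ℝ | δ / 2 * n ≤
      |((aliveB (θ n) S t).card : ℝ) - ∑ i, meanAliveB (Real.exp (-t)) (d n i, θ n i)|} :=
    measurableSet_le measurable_const ((measurable_card_aliveB (θ n) t).sub_const _).abs
  calc P n {ω | δ * n ≤ |((aliveB (θ n) (fun b => T n b ω) t).card : ℝ) -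
        n * hB p (Real.exp (-t))|}
      ≤ P n {ω | (fun b => T n b ω) ∈ {S : Ball (d n) → ℝ | δ / 2 * n ≤
          |((aliveB (θ n) S t).card : ℝ) -
            ∑ i, meanAliveB (Real.exp (-t)) (d n i, θ n i)|}} := by
        refine measure_mono fun ω hω => ?_
        simp only [Set.mem_ofPred_eq] at hω ⊢
        have h3 := abs_sub_le ((aliveB (θ n) (fun b => T n b ω) t).card : ℝ)
          (∑ i, meanAliveB (Real.exp (-t)) (d n i, θ n i)) (n * hB p (Real.exp (-t)))
        linarith
    _ = lifeLaw (Ball (d n)) {S : Ball (d n) → ℝ | δ / 2 * n ≤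
          |((aliveB (θ n) S t).card : ℝ) -
            ∑ i, meanAliveB (Real.exp (-t)) (d n i, θ n i)|} := (hTR n).measure_preimage hmeas
    _ ≤ ENNReal.ofReal ((∑ i, (d n i : ℝ) ^ 2) / (δ / 2 * n) ^ 2) :=
        lifeLaw_card_aliveB_le (θ n) ht hc
    _ ≤ ENNReal.ofReal (4 * C / δ ^ 2 / n) := by
        refine ENNReal.ofReal_le_ofReal ?_
        calc (∑ i, (d n i : ℝ) ^ 2) / (δ / 2 * n) ^ 2 ≤ C * n / (δ / 2 * n) ^ 2 := by gcongr
          _ = 4 * C / δ ^ 2 / n := by field_simp; ring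

theorem IsDriver.ae_good {n : ℕ} {d : Fin n → ℕ} {Ω : Type*} [MeasurableSpace Ω] {P : Measure Ω}
    [IsProbabilityMeasure P] {T : Ball d → Ω → ℝ} {R : ℕ → Ω → Selector (Ball d)}
    (h : IsDriver P T R) :
    ∀ᵐ ω ∂P, Function.Injective (fun b => T b ω) ∧ ∀ b, 0 < T b ω := by
  have h1 : ∀ᵐ S ∂(P.map fun ω b => T b ω), Function.Injective S ∧ ∀ b, 0 < S b := by
    rw [h.map_eq]
    exact ae_injective_lifeLaw.and ae_pos_lifeLaw
  exact ae_of_ae_map h.measurable_lifetimes.aemeasurable h1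

/-- The process stops before the time `-log z` with high probability if the drift is negative
at `z`. -/
theorem Regular.tendsto_lt_tau (h : Regular d θ p) (hTR : ∀ n, IsDriver (P n) (T n) (R n))
    {z : ℝ} (hz0 : 0 < z) (hz1 : z < 1) (hz : driftFn p z < 0) :
    Tendsto (fun n => P n {ω | -Real.log z < tau (θ n) (fun b => T n b ω) (fun k => R n k ω)})
      atTop (𝓝 0) := by
  set t := -Real.log z with ht
  have htpos : 0 < t := by rw [ht]; linarith [Real.log_neg hz0 hz1]
  have hzt : Real.exp (-t) = z := by rw [ht, neg_neg, Real.exp_log hz0]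
  have hcont : Tendsto (fun η : ℝ => meanDegree p * Real.exp (-(2 * (t - η)))) (𝓝[>] 0)
      (𝓝 (meanDegree p * z ^ 2)) := by
    have h1 : Continuous fun η : ℝ => meanDegree p * Real.exp (-(2 * (t - η))) := by fun_prop
    have h2 := h1.tendsto 0
    have h3 : Real.exp (-(2 * (t - 0))) = z ^ 2 := by
      rw [← hzt, ← Real.exp_nat_mul]; congr 1; push_cast; ring
    rw [h3] at h2
    exact h2.mono_left nhdsWithin_le_nhds
  have hlt : meanDegree p * z ^ 2 < hB p z := by
    have : meanDegree p * z ^ 2 - hB p z < 0 := hz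
    linarith
  have hIoo : ∀ᶠ η : ℝ in 𝓝[>] 0, η ∈ Set.Ioo 0 t := Ioo_mem_nhdsGT htpos
  -- By continuity the drift inequality survives evaluating `λ e^{-2a}` at the slightly earlier time
  -- `a = t - η`. The margin `η` then absorbs the fluctuation of the death time with index `deathsBy
  -- a M`.
  obtain ⟨η, hη1, hη0, hηt⟩ := ((hcont.eventually (gt_mem_nhds hlt)).and hIoo).exists
  set a := t - η with ha
  have hapos : 0 < a := by linarith
  obtain ⟨δ, hδ0, hδ⟩ : ∃ δ > 0, meanDegree p * Real.exp (-(2 * a)) < hB p z - δ :=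
    ⟨(hB p z - meanDegree p * Real.exp (-(2 * a))) / 2, by linarith, by linarith⟩
  have hsum := (h.tendsto_centredTime hTR hapos hη0).add (h.tendsto_card_aliveB hTR htpos.le hδ0)
  rw [add_zero] at hsum
  have hMlim : Tendsto (fun n : ℕ => ((∑ i, d n i : ℕ) : ℝ) / n * Real.exp (-(2 * a)) + 3 / n)
      atTop (𝓝 (meanDegree p * Real.exp (-(2 * a)) + 0)) :=
    (h.tendsto_sum_degree_div.mul_const _).add (tendsto_const_div_atTop_nhds_zero_nat 3)
  rw [add_zero] at hMlim
  refine tendsto_of_tendsto_of_tendsto_of_le_of_le' tendsto_const_nhds hsum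
    (Eventually.of_forall fun _ => zero_le) ?_
  filter_upwards [h.tendsto_sum_degree.eventually_ge_atTop 2, eventually_gt_atTop 0,
    hMlim.eventually (gt_mem_nhds hδ)] with n hM2 hn0 hMn
  have hn0' : (0 : ℝ) < n := by exact_mod_cast hn0
  refine le_trans (measure_mono_ae ?_) (measure_union_le _ _)
  filter_upwards [(hTR n).ae_good] with ω hω hbad
  by_contra hcon
  have hcon1 : ¬ (η ≤ |centredTime (θ n) (fun b => T n b ω) (fun k => R n k ω)
      (deathsBy a (∑ i, d n i))|) := fun hc => hcon (Or.inl hc)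
  have hcon2 : ¬ (δ * n ≤ |((aliveB (θ n) (fun b => T n b ω) t).card : ℝ) -
      n * hB p (Real.exp (-t))|) := fun hc => hcon (Or.inr hc)
  rw [not_le] at hcon1 hcon2
  rw [hzt] at hcon2
  have hbad : t < tau (θ n) (fun b => T n b ω) (fun k => R n k ω) := hbad
  obtain ⟨b1, b2, b3⟩ := deathsBy_bounds hapos hM2
  refine absurd (tau_le_of (θ := θ n) hω.1 hω.2 (fun k => R n k ω) (h.even_sum n)
    (k := deathsBy a (∑ i, d n i)) (t := t) (η := η) (by omega) ?_ ?_ ?_) (not_le.2 hbad)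
  · have := (abs_lt.1 hcon1).2
    rw [centredTime] at this
    linarith
  · have := meanTime_deathsBy_le hapos hM2
    linarith
  · have h1 := (abs_lt.1 hcon2).1
    have h2 : ((∑ i, d n i : ℕ) : ℝ) * Real.exp (-(2 * a)) + 3 < n * (hB p z - δ) := by
      have := mul_lt_mul_of_pos_right hMn hn0'
      have e : (((∑ i, d n i : ℕ) : ℝ) / n * Real.exp (-(2 * a)) + 3 / n) * n =
          ((∑ i, d n i : ℕ) : ℝ) * Real.exp (-(2 * a)) + 3 := by field_simp
      linarith
    have he := Real.exp_pos (-(2 * a))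
    have h3 : ((∑ i, d n i : ℕ) : ℝ) ≤ (((aliveB (θ n) (fun b => T n b ω) t).card +
        2 * deathsBy a (∑ i, d n i) : ℕ) : ℝ) := by
      push_cast at b2 h2 ⊢
      linarith
    exact_mod_cast h3

/-- The approximating point lies to the left of `u` because `aliveB` decreases: its size at `u` is
bounded by that at `g`. So a bound uniform over `[0, t]` follows from concentration at finitely many
times. -/
theorem exists_finset_near {f : ℝ → ℝ} {t δ : ℝ} (hf : ContinuousOn f (Set.Icc 0 t))
    (hδ : 0 < δ) : ∃ G : Finset ℝ, (∀ g ∈ G, 0 ≤ g) ∧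
      ∀ u ∈ Set.Icc 0 t, ∃ g ∈ G, g ≤ u ∧ |f g - f u| < δ := by
  have huc := isCompact_Icc.uniformContinuousOn_of_continuous hf
  rw [Metric.uniformContinuousOn_iff] at huc
  obtain ⟨ρ, hρ, huc⟩ := huc δ hδ
  have hρ2 : 0 < ρ / 2 := by positivity
  refine ⟨(Finset.range (⌊t / (ρ / 2)⌋₊ + 1)).image fun j : ℕ => (j : ℝ) * (ρ / 2), ?_, ?_⟩
  · intro g hg
    obtain ⟨j, -, rfl⟩ := Finset.mem_image.1 hg
    positivity
  · intro u hu
    have h1 : (⌊u / (ρ / 2)⌋₊ : ℝ) ≤ u / (ρ / 2) := Nat.floor_le (div_nonneg hu.1 hρ2.le)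
    have h2 := Nat.lt_floor_add_one (u / (ρ / 2))
    rw [le_div_iff₀ hρ2] at h1
    rw [div_lt_iff₀ hρ2] at h2
    refine ⟨_, Finset.mem_image.2 ⟨⌊u / (ρ / 2)⌋₊, Finset.mem_range.2 ?_, rfl⟩, h1, ?_⟩
    · exact Nat.lt_succ_of_le (Nat.floor_le_floor (by gcongr; exact hu.2))
    · rw [← Real.dist_eq]
      refine huc _ ⟨by positivity, h1.trans hu.2⟩ _ hu ?_
      rw [Real.dist_eq, abs_sub_comm, abs_of_nonneg (by linarith)]
      linarith

/-- The process does not stop before time `t` with high probability if the drift is positive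
on `[exp (-t), 1]`. -/
theorem Regular.tendsto_tau_le (h : Regular d θ p) (hTR : ∀ n, IsDriver (P n) (T n) (R n))
    {t : ℝ} (ht : 0 ≤ t) (hz : zHat p < Real.exp (-t)) :
    Tendsto (fun n => P n {ω | tau (θ n) (fun b => T n b ω) (fun k => R n k ω) ≤ t})
      atTop (𝓝 0) := by
  have hexp : ∀ u ∈ Set.Icc 0 t, Real.exp (-u) ∈ Set.Icc (Real.exp (-t)) 1 := fun u hu =>
    ⟨Real.exp_le_exp.2 (by linarith [hu.2]), (exp_neg_mem hu.1).2⟩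
  -- The margin `4δ` is spent on the grid, on the fluctuation of `aliveB` at grid times, on the
  -- error in `M - 2j`, and on an additive `1` that is less than `δ n`.
  obtain ⟨δ, hδ0, hδ⟩ : ∃ δ > 0, ∀ y ∈ Set.Icc (Real.exp (-t)) 1, 4 * δ ≤ driftFn p y := by
    obtain ⟨y, hy, hmin⟩ := isCompact_Icc.exists_isMinOn
      (Set.nonempty_Icc.2 (exp_neg_mem ht).2)
      (h.continuousOn_driftFn.mono (Set.Icc_subset_Icc_left (Real.exp_pos (-t)).le))
    refine ⟨driftFn p y / 4, ?_, fun x hx => ?_⟩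
    · have := h.driftFn_pos (hz.trans_le hy.1) hy.2
      positivity
    · have : driftFn p y ≤ driftFn p x := hmin hx
      linarith
  have hcontB : ContinuousOn (fun u => hB p (Real.exp (-u))) (Set.Icc 0 t) :=
    h.continuousOn_hB.comp (by fun_prop) fun u hu => exp_neg_mem hu.1
  obtain ⟨G, hG0, hG⟩ := exists_finset_near hcontB hδ0
  obtain ⟨η, hη0, hη⟩ : ∃ η > 0, meanDegree p * (1 - Real.exp (-(2 * η))) < δ / 2 := by
    have hc : Continuous fun η : ℝ => meanDegree p * (1 - Real.exp (-(2 * η))) := by fun_prop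
    have h1 := (hc.tendsto 0).mono_left (nhdsWithin_le_nhds (s := Set.Ioi 0))
    simp only [mul_zero, neg_zero, Real.exp_zero, sub_self] at h1
    obtain ⟨η, h2, h3⟩ := ((h1.eventually (gt_mem_nhds (half_pos hδ0))).and
      self_mem_nhdsWithin).exists
    exact ⟨η, h3, h2⟩
  -- The mean time of the chosen death is at least `t + 2η` for large `M`; a fluctuation of `η`
  -- still leaves it beyond `t`.
  have hapos : 0 < t + 3 * η := by linarith
  have hsum := (h.tendsto_centredTime hTR hapos hη0).add
    (tendsto_finsetSum G fun g hg => h.tendsto_card_aliveB hTR (hG0 g hg) hδ0)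
  rw [Finset.sum_const_zero, add_zero] at hsum
  refine tendsto_of_tendsto_of_tendsto_of_le_of_le' tendsto_const_nhds hsum
    (Eventually.of_forall fun _ => zero_le) ?_
  filter_upwards [h.tendsto_sum_degree.eventually_ge_atTop 2, eventually_gt_atTop 0,
    h.tendsto_sum_degree.eventually (eventually_le_meanTime_deathsBy hapos hη0),
    h.tendsto_sum_degree_div.eventually (lt_mem_nhds (sub_lt_self (meanDegree p) (half_pos hδ0))),
    (tendsto_natCast_atTop_atTop (R := ℝ)).eventually_gt_atTop (1 / δ)] with n hM2 hn0 hmt hMn hnδ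
  have hn0' : (0 : ℝ) < n := by exact_mod_cast hn0
  rw [lt_div_iff₀ hn0'] at hMn
  rw [div_lt_iff₀ hδ0] at hnδ
  refine le_trans (measure_mono_ae ?_) ((measure_union_le _ _).trans
    (add_le_add le_rfl (measure_biUnion_finset_le G _)))
  filter_upwards [(hTR n).ae_good] with ω hω hbad
  by_contra hcon
  have hcon1 : ¬ (η ≤ |centredTime (θ n) (fun b => T n b ω) (fun k => R n k ω)
      (deathsBy (t + 3 * η) (∑ i, d n i))|) := fun hc => hcon (Or.inl hc)
  have hcon2 : ∀ g ∈ G, ¬ (δ * n ≤ |((aliveB (θ n) (fun b => T n b ω) g).card : ℝ) -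
      n * hB p (Real.exp (-g))|) := fun g hg hc =>
    hcon (Or.inr (Set.mem_biUnion (Finset.mem_coe.2 hg) hc))
  rw [not_le] at hcon1
  have hbad : tau (θ n) (fun b => T n b ω) (fun k => R n k ω) ≤ t := hbad
  obtain ⟨b1, b2, b3⟩ := deathsBy_bounds hapos hM2
  refine absurd (lt_tau_of (θ := θ n) hω.1 hω.2 (fun k => R n k ω) (h.even_sum n)
    (k := deathsBy (t + 3 * η) (∑ i, d n i)) (t := t) (η := η) ?_ ?_ ?_) (not_lt.2 hbad)
  · have := (abs_lt.1 hcon1).1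
    rw [centredTime] at this
    linarith
  · linarith
  · intro u hu j hj hmj
    obtain ⟨g, hg, hgu, hgB⟩ := hG u hu
    have h1 := (abs_lt.1 (not_le.1 (hcon2 g hg))).2
    have h2 := (abs_lt.1 hgB).2
    have h3 : ((aliveB (θ n) (fun b => T n b ω) u).card : ℝ) ≤
        (aliveB (θ n) (fun b => T n b ω) g).card := by
      exact_mod_cast Finset.card_le_card (aliveB_anti (θ n) _ hgu)
    have h4 := hδ _ (hexp u hu)
    rw [driftFn] at h4
    have h5 := (le_meanTime (M := ∑ i, d n i) (k := j) (by omega)).trans hmj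
    set M : ℕ := ∑ i, d n i
    have hj' : (0 : ℝ) < M + 1 - 2 * j := by
      have : ((2 * j + 1 : ℕ) : ℝ) < M := by exact_mod_cast (by omega : 2 * j + 1 < M)
      push_cast at this
      linarith
    have hM1 : (0 : ℝ) < M + 1 := by positivity
    -- The lower bound for `meanTime`, exponentiated: at most the typical number of deaths can have
    -- occurred by time `u + η`.
    have h6 : ((M : ℝ) + 1) * Real.exp (-(2 * (u + η))) ≤ M + 1 - 2 * j := by
      rw [← Real.log_le_log_iff (by positivity) hj', Real.log_mul hM1.ne' (Real.exp_pos _).ne',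
        Real.log_exp]
      linarith
    set e1 := Real.exp (-u) ^ 2 with he1
    set e2 := Real.exp (-(2 * η)) with he2
    have he : Real.exp (-(2 * (u + η))) = e1 * e2 := by
      rw [he1, he2, ← Real.exp_nat_mul, ← Real.exp_add]; congr 1; push_cast; ring
    have he1p : 0 < e1 := by positivity
    have he1l : e1 ≤ 1 := pow_le_one₀ (Real.exp_pos _).le (exp_neg_mem hu.1).2
    have he2p : 0 < e2 := Real.exp_pos _
    have he2l : e2 ≤ 1 := Real.exp_le_one_iff.2 (by linarith)
    rw [he] at h6
    have h7 : (n : ℝ) * (meanDegree p * e1 - δ) ≤ (M + 1) * (e1 * e2) := by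
      have hle : e1 * e2 ≤ 1 := mul_le_one₀ he1l he2p.le he2l
      have hep : 0 < e1 * e2 := by positivity
      have hA : (n : ℝ) * (meanDegree p - δ / 2) * (e1 * e2) ≤ (M + 1) * (e1 * e2) :=
        mul_le_mul_of_nonneg_right (by linarith) hep.le
      have hB1 : meanDegree p * e1 - δ ≤ (meanDegree p - δ / 2) * (e1 * e2) := by
        have hB2 : e1 * (meanDegree p * (1 - e2)) ≤ 1 * (δ / 2) :=
          mul_le_mul he1l hη.le (mul_nonneg h.meanDegree_pos.le (by linarith)) zero_le_one
        have hB3 : δ / 2 * (e1 * e2) ≤ δ / 2 := mul_le_of_le_one_right (by positivity) hle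
        linarith
      calc (n : ℝ) * (meanDegree p * e1 - δ)
          ≤ n * ((meanDegree p - δ / 2) * (e1 * e2)) := mul_le_mul_of_nonneg_left hB1 hn0'.le
        _ ≤ (M + 1) * (e1 * e2) := by linarith
    have h8 : (n : ℝ) * hB p (Real.exp (-g)) ≤ n * (meanDegree p * e1 - 3 * δ) :=
      mul_le_mul_of_nonneg_left (by linarith) hn0'.le
    have h9 : (((aliveB (θ n) (fun b => T n b ω) u).card + 2 * j : ℕ) : ℝ) < (M : ℝ) := by
      push_cast
      linarith
    exact_mod_cast h9

end Limit

theorem tau_nonneg {n : ℕ} {d : Fin n → ℕ} (θ : Fin n → ℕ) (T : Ball d → ℝ)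
    (R : ℕ → Selector (Ball d)) : 0 ≤ tau θ T R :=
  Real.sInf_nonneg fun _ ht => ht.1

end ThresholdDiffusion

end

theorem mainTheorem2
    (d θ : (n : ℕ) → Fin n → ℕ) (p : ℕ × ℕ → ℝ)
    (hreg : ThresholdDiffusion.Regular d θ p)
    (hmin : ThresholdDiffusion.zHat p ≠ 0 →
      ¬ IsLocalMinOn (ThresholdDiffusion.driftFn p) (Set.Icc (0 : ℝ) 1)
        (ThresholdDiffusion.zHat p))
    {Ω : ℕ → Type*} [∀ n, MeasurableSpace (Ω n)]
    (P : (n : ℕ) → Measure (Ω n)) [∀ n, IsProbabilityMeasure (P n)]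
    (T : (n : ℕ) → ThresholdDiffusion.Ball (d n) → Ω n → ℝ)
    (R : (n : ℕ) → ℕ → Ω n → ThresholdDiffusion.Selector (ThresholdDiffusion.Ball (d n)))
    (hTR : ∀ n, ThresholdDiffusion.IsDriver (P n) (T n) (R n)) :
    (ThresholdDiffusion.zHat p ≠ 0 → ∀ ε : ℝ, 0 < ε →
      Tendsto (fun n => P n {ω | ε < |ThresholdDiffusion.tau (θ n) (fun b => T n b ω)
        (fun k => R n k ω) - (-Real.log (ThresholdDiffusion.zHat p))|}) atTop (𝓝 0)) ∧
    (ThresholdDiffusion.zHat p = 0 → ∀ K : ℝ,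
      Tendsto (fun n => P n {ω | ThresholdDiffusion.tau (θ n) (fun b => T n b ω)
        (fun k => R n k ω) ≤ K}) atTop (𝓝 0)) := by
  refine ⟨fun hz ε hε => ?_, fun hz K => ?_⟩
  · set y := ThresholdDiffusion.zHat p with hy
    obtain ⟨⟨hy0, hy1⟩, -⟩ := hreg.zHat_mem
    have hypos : 0 < y := lt_of_le_of_ne hy0 (Ne.symm hz)
    have hey : y * Real.exp (-ε) < y :=
      mul_lt_of_lt_one_right hypos (Real.exp_lt_one_iff.2 (by linarith))
    -- A point of negative drift in `(y e^{-ε}, y)` means stopping before `-log z`, which is less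
    -- than `-log y + ε`.
    obtain ⟨z, hz1, hz2, -, hz4⟩ := hreg.exists_driftFn_neg (hmin hz) hey
    have hz0 : 0 < z := lt_trans (by positivity) hz1
    have hupper := hreg.tendsto_lt_tau hTR hz0 (hz2.trans_le hy1) hz4
    have hlog : -Real.log z < -Real.log y + ε := by
      have := Real.log_lt_log (by positivity) hz1
      rw [Real.log_mul hypos.ne' (Real.exp_pos _).ne', Real.log_exp] at this
      linarith
    have hlower : Tendsto (fun n => P n {ω | ThresholdDiffusion.tau (θ n) (fun b => T n b ω)
        (fun k => R n k ω) < -Real.log y - ε}) atTop (𝓝 0) := by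
      -- For a negative time the event is empty, since `tau` is nonnegative; otherwise `exp` of
      -- minus that time is `y e^ε > y`, in the region of positive drift.
      by_cases ht : 0 ≤ -Real.log y - ε
      · have hyt : y < Real.exp (-(-Real.log y - ε)) := by
          rw [show -(-Real.log y - ε) = Real.log y + ε by ring, Real.exp_add, Real.exp_log hypos]
          exact lt_mul_of_one_lt_right hypos (Real.one_lt_exp_iff.2 hε)
        refine tendsto_of_tendsto_of_tendsto_of_le_of_le tendsto_const_nhds
          (hreg.tendsto_tau_le hTR ht hyt) (fun _ => zero_le) fun n => measure_mono fun ω hω => ?_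
        simp only [Set.mem_ofPred_eq] at hω ⊢
        exact hω.le
      · refine tendsto_const_nhds.congr fun n => ?_
        symm
        convert measure_empty (μ := P n)
        ext ω
        have := ThresholdDiffusion.tau_nonneg (θ n) (fun b => T n b ω) fun k => R n k ω
        simp only [Set.mem_ofPred_eq, Set.mem_empty_iff_false, iff_false, not_lt]
        linarith
    have hsum := hupper.add hlower
    rw [add_zero] at hsum
    refine tendsto_of_tendsto_of_tendsto_of_le_of_le tendsto_const_nhds hsum
      (fun _ => zero_le) fun n => (measure_mono fun ω hω => ?_).trans (measure_union_le _ _)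
    have hω : ε < |_| := hω
    rcases lt_abs.1 hω with h | h
    · refine Or.inl ?_
      simp only [Set.mem_ofPred_eq]
      linarith
    · refine Or.inr ?_
      simp only [Set.mem_ofPred_eq]
      linarith
  · refine tendsto_of_tendsto_of_tendsto_of_le_of_le tendsto_const_nhds
      (hreg.tendsto_tau_le hTR (t := max K 0) (le_max_right _ _) (by rw [hz]; exact Real.exp_pos _))
      (fun _ => zero_le) fun n => measure_mono fun ω hω => ?_
    exact le_trans hω (le_max_left K 0)
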